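/- **Definitions.** A *sequential data structure* (sds) $\mathbf S=(C,V,P)$ consists of disjoint sets $C$ (cells) and $V$ (values) and a set $P$ of non-empty words (positions) of the form $c_1v_1\cdots c_nv_n$ or $c_1v_1\cdots c_{n-1}v_{n-1}c_n$ ($c_i\in C$, $v_i\in V$), closed under non-empty prefixes. Positions ending with a value are *responses* (set $R$), positions ending with a cell are *queries* (set $Q$). Words are ordered by the prefix ordering, $\wedge$ denotes longest common prefix and $\epsilon$ the empty word. A *strategy* is a set $x\subseteq R$ closed under response prefixes and such that $r_1\wedge r_2\in x$ whenever $r_1,r_2\in x$ and $r_1\wedge r_2\neq\epsilon$. A *counter-strategy* is a non-empty set $\alpha\subseteq Q$ closed under query prefixes and under binary $\wedge$. $D(\mathbf S)$ and $D^{\bot}(\mathbf S)$ are the sets of strategies and of counter-strategies, ordered by inclusion. For a strategy $x$ and a counter-strategy $\alpha$, let $\langle x|\alpha\rangle$ be the maximum (for the prefix ordering) of the set of positions all of whose response prefixes are in $x$ and all of whose query prefixes are in $\alpha$ (this set is a chain; the maximum exists if $x$ or $\alpha$ is finite). $x$ *wins* against $\alpha$ if the maximum exists and is a response; $\alpha$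 *wins* against $x$ if it exists and is a query. The sds $\mathbf S\multimap\mathbf S'$ has cells $\mathit{request}\,c'$ ($c'\in C'$) and $\mathit{is}\,v$ ($v\in V$), values $\mathit{output}\,v'$ ($v'\in V'$) and $\mathit{valof}\,c$ ($c\in C$), and as positions the alternating words $s$ starting with some $\mathit{request}\,c'$ such that $s\lceil_{\mathbf S'}\in P'$, $s\lceil_{\mathbf S}\in P\cup\{\epsilon\}$, and no $(\mathit{valof}\,c)$ is immediately followed by a $(\mathit{request}\,c')$ in $s$; here $s\lceil_{\mathbf S}$ and $s\lceil_{\mathbf S'}$ are the subwords of moves of $\mathbf S$ and of $\mathbf S'$, tags erased. *Affine sequential algorithms* from $\mathbf S$ to $\mathbf S'$ are the elements of $D(\mathbf S\multimap\mathbf S')$. A *symmetric algorithm* from $\mathbf S$ to $\mathbf S'$ is a pair $(f,g)$ of a Scott-continuous function $f:D(\mathbf S)\to D(\mathbf S')$ and a Scott-continuous partial function $g:D^{\bot}(\mathbf S')\rightharpoonup D^{\bot}(\mathbf S)$ (Scott-open domain, continuous on it) such that: * (L) if $x\in D(\mathbf S)$, $\alpha'\in D^{\bot}(\mathbf S')$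 is finite and $f(x)$ wins against $\alpha'$, then there is a minimum $m$ among the strategies $y\subseteq x$ such that $f(y)$ wins against $\alpha'$; if $g(\alpha')$ is undefined, $m=\emptyset$; if $g(\alpha')$ is defined, $x$ wins against $g(\alpha')$ and $m$ is the set of response prefixes of $\langle x|g(\alpha')\rangle$; * (R) if $\alpha'\in D^{\bot}(\mathbf S')$, $x\in D(\mathbf S)$ is finite, $g(\alpha')$ is defined and wins against $x$, then $\alpha'$ wins against $f(x)$, and the set of query prefixes of $\langle f(x)|\alpha'\rangle$ is the minimum among the counter-strategies $\beta'\subseteq\alpha'$ such that $g(\beta')$ is defined and wins against $x$. Symmetric algorithms are ordered componentwise and pointwise, "undefined" being least. The composition of $(f,g)$ from $\mathbf S$ to $\mathbf S'$ and $(f',g')$ from $\mathbf S'$ to $\mathbf S''$ is $(f'\circ f,\,g\circ g')$, where $g\circ g'$ is the composition of partial functions. For $\phi\in D(\mathbf S\multimap\mathbf S')$ and $\phi'\in D(\mathbf S'\multimap\mathbf S'')$, consider triples $(s,s',s'')$ of words, each a position of $\mathbf S\multimap\mathbf S'$, $\mathbf S'\multimap\mathbf S''$, $\mathbf S\multimap\mathbf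 S''$ respectively or empty, rewritten by the following rules (letters $r$ stand for responses or $\epsilon$, letters $q$ for queries; tags are omitted; $P_{\mathbf S\multimap\mathbf S''}$ is the set of positions of $\mathbf S\multimap\mathbf S''$): $$\begin{array}{lll} (r,r',r'')\to(r,r'c'',r''c'') & (r''c''\in P_{\mathbf S\multimap\mathbf S''})\\ (r,r',r'')\to(rv,r',r''v) & (r''v\in P_{\mathbf S\multimap\mathbf S''})\\ (r,q',q'')\to(r,q'v'',q''v'') & (q'v''\in\phi')\\ (r,q',q'')\to(rc',q'c',q'') & (q'c'\in\phi')\\ (q,r',q'')\to(qv',r'v',q'') & (qv'\in\phi)\\ (q,r',q'')\to(qc,r',q''c) & (qc\in\phi) \end{array}$$ The composition of $\phi$ and $\phi'$ by the abstract machine is the set of all responses $s''$ of $\mathbf S\multimap\mathbf S''$ for which some $(s,s',s'')$ is reachable from $(\epsilon,\epsilon,\epsilon)$. **Theorem.** For all sds's $\mathbf S,\mathbf S'$, the assignment to $\phi\in D(\mathbf S\multimap\mathbf S')$ of the pair $(f_\phi,g_\phi)$ given by $$f_\phi(x)=\{s\lceil_{\mathbf S'} : s\in\phi,\ s\lceil_{\mathbf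 S}\in x\cup\{\epsilon\}\},\qquad g_\phi(\alpha')=\{s\lceil_{\mathbf S} : s\in\phi,\ s\lceil_{\mathbf S'}\in\alpha'\}$$ ($g_\phi(\alpha')$ being undefined when the right-hand set is empty) is a well-defined order isomorphism, in particular a bijection, from the set of affine sequential algorithms from $\mathbf S$ to $\mathbf S'$ onto the set of symmetric algorithms from $\mathbf S$ to $\mathbf S'$. Moreover, for all sds's $\mathbf S,\mathbf S',\mathbf S''$ and all $\phi\in D(\mathbf S\multimap\mathbf S')$, $\phi'\in D(\mathbf S'\multimap\mathbf S'')$, the composition $\phi''$ of $\phi$ and $\phi'$ by the abstract machine is an affine sequential algorithm from $\mathbf S$ to $\mathbf S''$, and $$f_{\phi''}=f_{\phi'}\circ f_\phi,\qquad g_{\phi''}=g_\phi\circ g_{\phi'}.$$ -/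

import Mathlib

universe u

/-- A word over `C ⊕ V` is alternating if it has the form `c₁ v₁ c₂ v₂ ⋯`: it starts with a cell
(when it is non-empty), and cells and values alternate. -/
def AlternatingWord {C V : Type*} (w : List (C ⊕ V)) : Prop :=
  (∀ m ∈ w.head?, m.isLeft = true) ∧ w.IsChain (fun m n => m.isLeft ≠ n.isLeft)

/-- A sequential data structure `(C, V, P)`. The moves are the elements of the disjoint union of
cells and values. -/
structure SDS where
  C : Type u
  V : Type u
  P : Set (List (C ⊕ V))
  ne_nil : ∀ p ∈ P, p ≠ []
  alternating : ∀ p ∈ P, AlternatingWord p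
  prefix_mem : ∀ p ∈ P, ∀ w, w <+: p → w ≠ [] → w ∈ P

namespace SDS

abbrev Move (S : SDS.{u}) : Type u := S.C ⊕ S.V

abbrev Word (S : SDS.{u}) : Type u := List S.Move

/-- Positions that end with a cell. -/
def queries (S : SDS.{u}) : Set S.Word := {p | p ∈ S.P ∧ ∃ w c, p = w ++ [Sum.inl c]}

/-- Positions that end with a value. -/
def responses (S : SDS.{u}) : Set S.Word := {p | p ∈ S.P ∧ ∃ w v, p = w ++ [Sum.inr v]}

/-- `p` is the greatest lower bound of `a` and `b` for the prefix ordering of words. -/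
def IsMeet {M : Type*} (p a b : List M) : Prop :=
  p <+: a ∧ p <+: b ∧ ∀ w, w <+: a → w <+: b → w <+: p

/-- Strategies: the elements of `D(S)`. -/
@[ext]
structure Strategy (S : SDS.{u}) where
  carrier : Set S.Word
  subset_responses : carrier ⊆ S.responses
  prefix_mem : ∀ r ∈ carrier, ∀ t ∈ S.responses, t <+: r → t ∈ carrier
  meet_mem : ∀ r₁ ∈ carrier, ∀ r₂ ∈ carrier, ∀ p, IsMeet p r₁ r₂ → p ≠ [] → p ∈ carrier

/-- Counter-strategies: the elements of `D^⊥(S)`. -/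
@[ext]
structure CounterStrategy (S : SDS.{u}) where
  carrier : Set S.Word
  nonempty : carrier.Nonempty
  subset_queries : carrier ⊆ S.queries
  prefix_mem : ∀ q ∈ carrier, ∀ t ∈ S.queries, t <+: q → t ∈ carrier
  meet_mem : ∀ q₁ ∈ carrier, ∀ q₂ ∈ carrier, ∀ p, IsMeet p q₁ q₂ → p ∈ carrier

/-- Strategies are ordered by inclusion. -/
instance (S : SDS.{u}) : PartialOrder (Strategy S) :=
  PartialOrder.lift Strategy.carrier fun _ _ h => Strategy.ext h

/-- Counter-strategies are ordered by inclusion. -/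
instance (S : SDS.{u}) : PartialOrder (CounterStrategy S) :=
  PartialOrder.lift CounterStrategy.carrier fun _ _ h => CounterStrategy.ext h

/-- The play `⟨x | α⟩` as a set of positions. -/
def play {S : SDS.{u}} (x : Strategy S) (α : CounterStrategy S) : Set S.Word :=
  {p | p ∈ S.P ∧ (∀ r ∈ S.responses, r <+: p → r ∈ x.carrier) ∧
    (∀ q ∈ S.queries, q <+: p → q ∈ α.carrier)}

/-- `p` is the maximum element of the play of `x` against `α`. (It exists, uniquely, as soon as
one of `x`, `α` is finite.) -/
def IsPlay {S : SDS.{u}} (x : Strategy S) (α : CounterStrategy S) (p : S.Word) : Prop :=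
  p ∈ play x α ∧ ∀ p' ∈ play x α, p' <+: p

/-- `x` wins against `α`: the play ends with a response. -/
def Wins {S : SDS.{u}} (x : Strategy S) (α : CounterStrategy S) : Prop :=
  ∃ r ∈ S.responses, IsPlay x α r

/-- `α` wins against `x`: the play ends with a query. -/
def Loses {S : SDS.{u}} (x : Strategy S) (α : CounterStrategy S) : Prop :=
  ∃ q ∈ S.queries, IsPlay x α q

/-! ### The sds of affine algorithms -/

/-- Cells of the affine arrow. -/
inductive ArrowCell (S S' : SDS.{u}) : Type u
  | request (c' : S'.C)
  | is (v : S.V)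

/-- Values of the affine arrow. -/
inductive ArrowValue (S S' : SDS.{u}) : Type u
  | output (v' : S'.V)
  | valof (c : S.C)

abbrev ArrowMove (S S' : SDS.{u}) : Type u := ArrowCell S S' ⊕ ArrowValue S S'

abbrev ArrowWord (S S' : SDS.{u}) : Type u := List (ArrowMove S S')

section
variable {S S' : SDS.{u}}

abbrev request (c' : S'.C) : ArrowMove S S' := Sum.inl (ArrowCell.request c')
abbrev is (v : S.V) : ArrowMove S S' := Sum.inl (ArrowCell.is v)
abbrev output (v' : S'.V) : ArrowMove S S' := Sum.inr (ArrowValue.output v')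
abbrev valof (c : S.C) : ArrowMove S S' := Sum.inr (ArrowValue.valof c)

/-- The `S`-move underlying a move of the arrow, if any. -/
def inMove : ArrowMove S S' → Option S.Move
  | Sum.inl (ArrowCell.request _) => none
  | Sum.inl (ArrowCell.is v) => some (Sum.inr v)
  | Sum.inr (ArrowValue.output _) => none
  | Sum.inr (ArrowValue.valof c) => some (Sum.inl c)

/-- The `S'`-move underlying a move of the arrow, if any. -/
def outMove : ArrowMove S S' → Option S'.Move
  | Sum.inl (ArrowCell.request c') => some (Sum.inl c')
  | Sum.inl (ArrowCell.is _) => none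
  | Sum.inr (ArrowValue.output v') => some (Sum.inr v')
  | Sum.inr (ArrowValue.valof _) => none

/-- The projection of a word to the input sds `S` (tags are erased). -/
def projIn (s : ArrowWord S S') : S.Word := s.filterMap inMove

/-- The projection of a word to the output sds `S'` (tags are erased). -/
def projOut (s : ArrowWord S S') : S'.Word := s.filterMap outMove

end

/-- The positions of the affine arrow. -/
def arrowPositions (S S' : SDS.{u}) : Set (ArrowWord S S') :=
  {s | AlternatingWord s ∧ (∃ c', s.head? = some (request c')) ∧
    projOut s ∈ S'.P ∧ (projIn s = [] ∨ projIn s ∈ S.P) ∧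
    ¬ ∃ (w : ArrowWord S S') (c : S.C) (c' : S'.C), w ++ [valof c, request c'] <+: s}

/-- The affine arrow `S ⊸ S'`; its strategies are the affine (sequential) algorithms from `S`
to `S'`. -/
abbrev lolli (S S' : SDS.{u}) : SDS.{u} where
  C := ArrowCell S S'
  V := ArrowValue S S'
  P := arrowPositions S S'
  ne_nil := by
    rintro p ⟨-, ⟨c', h⟩, -⟩ rfl
    simp at h
  alternating := fun p hp => hp.1
  prefix_mem := by
    rintro p ⟨⟨h0, h1⟩, ⟨c', h2⟩, h3, h4, h5⟩ w hw hne
    have hhead : w.head? = p.head? := by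
      obtain ⟨t, rfl⟩ := hw
      cases w with
      | nil => exact absurd rfl hne
      | cons a w => rfl
    refine ⟨⟨by rwa [hhead], h1.prefix hw⟩, ⟨c', by rw [hhead, h2]⟩, ?_, ?_, ?_⟩
    · refine S'.prefix_mem _ h3 _ (hw.filterMap _) ?_
      cases w with
      | nil => exact absurd rfl hne
      | cons a w =>
        have : a = request c' := by simpa [h2] using hhead
        subst this
        simp [projOut, outMove]
    · by_cases h : projIn w = []
      · exact Or.inl h
      · refine Or.inr ?_
        have hpre : projIn w <+: projIn p := hw.filterMap _
        rcases h4 with h4 | h4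
        · rw [h4] at hpre
          exact absurd (List.prefix_nil.1 hpre) h
        · exact S.prefix_mem _ h4 _ hpre h
    · rintro ⟨u, c, d, h⟩
      exact h5 ⟨u, c, d, h.trans hw⟩

/-! ### Composition of affine algorithms by the abstract machine -/

/-- Responses together with the empty word. -/
def responses₀ (S : SDS.{u}) : Set S.Word := {r | r = [] ∨ r ∈ S.responses}

/-- The rewriting rules of the machine composing `φ` and `φ'`. The first two rules are moves of the
observer. -/
inductive MachineStep {S S' S'' : SDS.{u}}
    (φ : Strategy (lolli S S')) (φ' : Strategy (lolli S' S'')) :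
    ArrowWord S S' × ArrowWord S' S'' × ArrowWord S S'' →
    ArrowWord S S' × ArrowWord S' S'' × ArrowWord S S'' → Prop
  | observer_request (r : ArrowWord S S') (r' : ArrowWord S' S'') (r'' : ArrowWord S S'')
      (c'' : S''.C) (hr : r ∈ (lolli S S').responses₀) (hr' : r' ∈ (lolli S' S'').responses₀)
      (hr'' : r'' ∈ (lolli S S'').responses₀)
      (h : r'' ++ [request c''] ∈ (lolli S S'').P) :
      MachineStep φ φ' (r, r', r'') (r, r' ++ [request c''], r'' ++ [request c''])
  | observer_is (r : ArrowWord S S') (r' : ArrowWord S' S'') (r'' : ArrowWord S S'')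
      (v : S.V) (hr : r ∈ (lolli S S').responses₀) (hr' : r' ∈ (lolli S' S'').responses₀)
      (hr'' : r'' ∈ (lolli S S'').responses₀)
      (h : r'' ++ [is v] ∈ (lolli S S'').P) :
      MachineStep φ φ' (r, r', r'') (r ++ [is v], r', r'' ++ [is v])
  | right_output (r : ArrowWord S S') (q' : ArrowWord S' S'') (q'' : ArrowWord S S'')
      (v'' : S''.V) (hr : r ∈ (lolli S S').responses₀) (hq' : q' ∈ (lolli S' S'').queries)
      (hq'' : q'' ∈ (lolli S S'').queries)
      (h : q' ++ [output v''] ∈ φ'.carrier) :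
      MachineStep φ φ' (r, q', q'') (r, q' ++ [output v''], q'' ++ [output v''])
  | right_valof (r : ArrowWord S S') (q' : ArrowWord S' S'') (q'' : ArrowWord S S'')
      (c' : S'.C) (hr : r ∈ (lolli S S').responses₀) (hq' : q' ∈ (lolli S' S'').queries)
      (hq'' : q'' ∈ (lolli S S'').queries)
      (h : q' ++ [valof c'] ∈ φ'.carrier) :
      MachineStep φ φ' (r, q', q'') (r ++ [request c'], q' ++ [valof c'], q'')
  | left_output (q : ArrowWord S S') (r' : ArrowWord S' S'') (q'' : ArrowWord S S'')
      (v' : S'.V) (hq : q ∈ (lolli S S').queries) (hr' : r' ∈ (lolli S' S'').responses₀)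
      (hq'' : q'' ∈ (lolli S S'').queries)
      (h : q ++ [output v'] ∈ φ.carrier) :
      MachineStep φ φ' (q, r', q'') (q ++ [output v'], r' ++ [is v'], q'')
  | left_valof (q : ArrowWord S S') (r' : ArrowWord S' S'') (q'' : ArrowWord S S'')
      (c : S.C) (hq : q ∈ (lolli S S').queries) (hr' : r' ∈ (lolli S' S'').responses₀)
      (hq'' : q'' ∈ (lolli S S'').queries)
      (h : q ++ [valof c] ∈ φ.carrier) :
      MachineStep φ φ' (q, r', q'') (q ++ [valof c], r', q'' ++ [valof c])

/-- The composition of `φ` and `φ'`: the responses of `S ⊸ S''` that the machine computes,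
starting from three empty words. -/
def machineComp {S S' S'' : SDS.{u}}
    (φ : Strategy (lolli S S')) (φ' : Strategy (lolli S' S'')) : Set (ArrowWord S S'') :=
  {s'' | s'' ∈ (lolli S S'').responses ∧
    ∃ s s', Relation.ReflTransGen (MachineStep φ φ') ([], [], []) (s, s', s'')}

/-! ### Symmetric algorithms -/

/-- A symmetric algorithm `(f, g)` from `S` to `S'`. The partial function `g` takes values in
`WithBot (CounterStrategy S)`, where `⊥` means "undefined"; Scott continuity of `g` in this sense
says that the domain of definition is Scott open and that `g` is continuous there. A play that ends
in a response `r` (resp. a query `q`) is identified with the set of response prefixes of `r`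
(resp. of query prefixes of `q`). -/
@[ext]
structure SymmetricAlgorithm (S S' : SDS.{u}) where
  f : Strategy S → Strategy S'
  g : CounterStrategy S' → WithBot (CounterStrategy S)
  f_continuous : ScottContinuous f
  g_continuous : ScottContinuous g
  /-- Axiom (L). The minimum `y` is `m(f, x, α')`; it is empty if `g α'` is undefined, and
  otherwise it is the play of `x` against `g α'`, won by `x`. -/
  axiomL : ∀ (x : Strategy S) (α' : CounterStrategy S'), α'.carrier.Finite → Wins (f x) α' →
    ∃ y : Strategy S, IsLeast {z : Strategy S | z ≤ x ∧ Wins (f z) α'} y ∧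
      ((g α' = ⊥ ∧ y.carrier = ∅) ∨
        ∃ (α : CounterStrategy S) (r : S.Word), g α' = (α : WithBot (CounterStrategy S)) ∧
          r ∈ S.responses ∧ IsPlay x α r ∧ y.carrier = {t | t ∈ S.responses ∧ t <+: r})
  /-- Axiom (R). The minimum `β` is `m(g, α', x)`; it is the play of `f x` against `α'`,
  won by `α'`. -/
  axiomR : ∀ (α' : CounterStrategy S') (x : Strategy S) (α : CounterStrategy S),
    x.carrier.Finite → g α' = (α : WithBot (CounterStrategy S)) → Loses x α →
    ∃ β : CounterStrategy S',
      IsLeast {γ : CounterStrategy S' | γ ≤ α' ∧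
        ∃ δ : CounterStrategy S, g γ = (δ : WithBot (CounterStrategy S)) ∧ Loses x δ} β ∧
      ∃ q' ∈ S'.queries, IsPlay (f x) α' q' ∧ β.carrier = {t | t ∈ S'.queries ∧ t <+: q'}

/-- Symmetric algorithms are ordered componentwise and pointwise ("undefined" is least). -/
instance (S S' : SDS.{u}) : PartialOrder (SymmetricAlgorithm S S') :=
  PartialOrder.lift (fun a => (a.f, a.g)) fun _ _ h =>
    SymmetricAlgorithm.ext (Prod.ext_iff.1 h).1 (Prod.ext_iff.1 h).2

/-- Composition of partial functions: `(g ∘ g') a` is defined iff `g' a` is defined and `g` is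
defined at `g' a`. -/
def partialComp {A B E : Type*} (g : B → WithBot A) (g' : E → WithBot B) : E → WithBot A :=
  fun a => WithBot.recBotCoe ⊥ g (g' a)

/-- The function on strategies defined by the affine algorithm `φ` at `x`, as a set. An empty input
projection counts as belonging to every strategy. -/
def applyFun {S S' : SDS.{u}} (φ : Strategy (lolli S S')) (x : Strategy S) : Set S'.Word :=
  {r' | ∃ s ∈ φ.carrier, r' = projOut s ∧ (projIn s = [] ∨ projIn s ∈ x.carrier)}

/-- The partial function on counter-strategies defined by the affine algorithm `φ` at `α'`, as a
set; an empty set means "undefined". -/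
def applyCounter {S S' : SDS.{u}} (φ : Strategy (lolli S S')) (α' : CounterStrategy S') :
    Set S.Word :=
  {q | ∃ s ∈ φ.carrier, q = projIn s ∧ projOut s ∈ α'.carrier}

/-- The underlying set of a possibly undefined counter-strategy: empty exactly if undefined. -/
def partialCarrier {S : SDS.{u}} (a : WithBot (CounterStrategy S)) : Set S.Word :=
  {q | ∃ α : CounterStrategy S, a = (α : WithBot (CounterStrategy S)) ∧ q ∈ α.carrier}

end SDS

/-!
Everything rests on one observation about an affine algorithm `φ`. Two elements of `φ` fork either
at a `request`, which is a fork of their output projections after a response, or at an `is`, which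
is a fork of their input projections after a query. Hence the elements of `φ` whose input
projections follow a given strategy `x` and whose output projections follow a given
counter-strategy `α'` form a chain (`prefix_or_prefix_of_mem`). The longest element of this chain,
if any, projects to the play of `x` against `g_φ α'` and to the play of `f_φ x` against `α'`, and
its last move tells which player is stuck. This gives axioms (L) and (R) (`applyStrategy_axiomL`,
`applyPartial_axiomR`).

Conversely, a symmetric algorithm `(f, g)` has a trace: the responses of the arrow each of whose
moves is justified, an `output` by the value of `f` on the input explored so far, a `valof` by the
value of `g` on the output explored so far. The two justifications exclude each other at a query,
because a play is not won by both players, so the trace is an affine algorithm. It defines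
`(f, g)`: if `f x` has a value that `f` does not yet produce on the input explored so far, axiom (L)
says that `g` asks for more input and that `x` answers; this extends the position, and the play
provided by (L) bounds the length of such positions (`SymmetricAlgorithm.subset_applyFun`). Axiom
(R) plays the dual role for `g` (`SymmetricAlgorithm.subset_applyCounter`). Finally `φ` is
contained in the trace of `(f_φ, g_φ)`, both define the same functions, and an element of an
affine algorithm is determined by what it contributes to these functions (`eq_of_projOut_eq`,
`eq_of_projIn_eq`); so the two constructions are inverse to each other, and both are monotone.

A reachable state `(s, s', s'')` of the abstract machine consists of positions played according to
`φ` and `φ'` that agree on the three sds's, and conversely any two responses of `φ` and `φ'` that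
agree on the intermediate sds are interleaved by some run (`exists_reachable`). This yields the
formulas for the functions of the composition (`applyFun_comp_eq`, `applyCounter_comp_eq`). That
the composition is deterministic follows from its being contained in the trace of the composite
functions, in which a conflict would be a play in the intermediate sds won by both players
(`Orthogonal.comp`).
-/

namespace SDS

/-! ### Words -/

section Words

variable {C V : Type*}

/-- The word `w` ends with a cell. The empty word does not, so that `¬ EndsCell w` says that `w` is
empty or ends with a value. -/
def EndsCell (w : List (C ⊕ V)) : Prop := ∃ u c, w = u ++ [Sum.inl c]

@[simp] theorem not_endsCell_nil : ¬ EndsCell ([] : List (C ⊕ V)) := by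
  rintro ⟨u, c, h⟩
  simp at h

@[simp] theorem endsCell_append_singleton (w : List (C ⊕ V)) (m : C ⊕ V) :
    EndsCell (w ++ [m]) ↔ m.isLeft = true := by
  constructor
  · rintro ⟨u, c, h⟩
    obtain ⟨-, h⟩ := List.append_inj' h rfl
    simp_all
  · intro h
    cases m with
    | inl c => exact ⟨w, c, rfl⟩
    | inr v => simp at h

@[simp] theorem endsCell_singleton (m : C ⊕ V) : EndsCell [m] ↔ m.isLeft = true :=
  endsCell_append_singleton [] m

theorem ends_value_of_not_endsCell {w : List (C ⊕ V)} (hw : w ≠ []) (h : ¬ EndsCell w) :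
    ∃ u v, w = u ++ [Sum.inr v] := by
  obtain ⟨u, m, rfl⟩ := List.eq_nil_or_concat w |>.resolve_left hw
  cases m with
  | inl c => simp at h
  | inr v => exact ⟨u, v, by simp⟩

theorem alternatingWord_nil : AlternatingWord ([] : List (C ⊕ V)) := by
  simp [AlternatingWord]

theorem alternatingWord_append_singleton {w : List (C ⊕ V)} {m : C ⊕ V} :
    AlternatingWord (w ++ [m]) ↔ AlternatingWord w ∧ (m.isLeft = true ↔ ¬ EndsCell w) := by
  rcases List.eq_nil_or_concat w with rfl | ⟨u, n, rfl⟩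
  · simp [AlternatingWord]
  · have hh : ((u ++ [n]) ++ [m]).head? = (u ++ [n]).head? := by cases u <;> rfl
    rw [List.concat_eq_append, AlternatingWord, AlternatingWord, hh, List.isChain_append,
      endsCell_append_singleton]
    cases m <;> cases n <;> simp

theorem prefix_or_fork {M : Type*} (a b : List M) :
    a <+: b ∨ b <+: a ∨ ∃ w m n, m ≠ n ∧ w ++ [m] <+: a ∧ w ++ [n] <+: b := by
  induction a generalizing b with
  | nil => exact Or.inl (List.nil_prefix)
  | cons x a ih =>
    cases b with
    | nil => exact Or.inr (Or.inl List.nil_prefix)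
    | cons y b =>
      by_cases hxy : x = y
      · subst hxy
        rcases ih b with h | h | ⟨w, m, n, hmn, h1, h2⟩
        · exact Or.inl (by simpa using h)
        · exact Or.inr (Or.inl (by simpa using h))
        · exact Or.inr (Or.inr ⟨x :: w, m, n, hmn, by simpa using h1, by simpa using h2⟩)
      · exact Or.inr (Or.inr ⟨[], x, y, hxy, by simp, by simp⟩)

theorem eq_or_append_prefix {M : Type*} {a b : List M} (h : a <+: b) :
    a = b ∨ ∃ m, a ++ [m] <+: b := by
  obtain ⟨t, rfl⟩ := h
  cases t with
  | nil => exact Or.inl (by simp)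
  | cons m t => exact Or.inr ⟨m, t, by simp⟩

theorem prefix_antisymm {M : Type*} {a b : List M} (h : a <+: b) (h' : b <+: a) : a = b :=
  h.eq_of_length (le_antisymm h.length_le h'.length_le)

theorem not_append_prefix_self {M : Type*} {a : List M} {m : M} : ¬ a ++ [m] <+: a := by
  intro h
  have := h.length_le
  simp at this

theorem exists_append_prefix_of_filterMap {M N : Type*} {f : M → Option N} {l : List M}
    {a : List N} {n : N} (h : a ++ [n] <+: l.filterMap f) :
    ∃ k m, k ++ [m] <+: l ∧ k.filterMap f = a ∧ f m = some n := by
  induction l generalizing a with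
  | nil => simp at h
  | cons x l ih =>
    cases hx : f x with
    | none =>
      rw [List.filterMap_cons_none hx] at h
      obtain ⟨k, m, h1, h2, h3⟩ := ih h
      exact ⟨x :: k, m, by simpa using h1, by simpa [hx] using h2, h3⟩
    | some y =>
      rw [List.filterMap_cons_some hx] at h
      cases a with
      | nil =>
        have : n = y := by simpa using h
        exact ⟨[], x, by simp, rfl, by rw [hx, this]⟩
      | cons b a =>
        rw [List.cons_append, List.cons_prefix_cons] at h
        obtain ⟨k, m, h1, h2, h3⟩ := ih h.2
        exact ⟨x :: k, m, by simpa using h1, by rw [List.filterMap_cons_some hx, h2, h.1], h3⟩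

/-- An inductive search along objects of bounded size: if every candidate either settles the goal or
yields a larger candidate, the goal holds. -/
theorem of_bounded_extension {A : Type*} {good : A → Prop} {goal : Prop} (size : A → ℕ) (K : ℕ)
    (hbound : ∀ a, good a → size a ≤ K)
    (hstep : ∀ a, good a → goal ∨ ∃ b, good b ∧ size a < size b) {a : A} (ha : good a) : goal := by
  induction hn : K - size a using Nat.strong_induction_on generalizing a with
  | _ n ih =>
    rcases hstep a ha with h | ⟨b, hb, hlt⟩
    · exact h
    · have := hbound b hb
      exact ih (K - size b) (by omega) hb rfl

end Words

/-! ### Strategies and counter-strategies -/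

section Basic

variable {S : SDS.{u}}

theorem mem_responses_iff {p : S.Word} : p ∈ S.responses ↔ p ∈ S.P ∧ ¬ EndsCell p := by
  constructor
  · rintro ⟨hp, w, v, rfl⟩
    exact ⟨hp, by simp⟩
  · rintro ⟨hp, h⟩
    exact ⟨hp, ends_value_of_not_endsCell (S.ne_nil _ hp) h⟩

theorem mem_queries_iff {p : S.Word} : p ∈ S.queries ↔ p ∈ S.P ∧ EndsCell p := Iff.rfl

theorem not_endsCell_of_append_cell {p : S.Word} {c : S.C} (h : p ++ [Sum.inl c] ∈ S.P) :
    ¬ EndsCell p :=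
  (alternatingWord_append_singleton.1 (S.alternating _ h)).2.1 rfl

theorem endsCell_of_append_value {p : S.Word} {v : S.V} (h : p ++ [Sum.inr v] ∈ S.P) :
    EndsCell p := by
  by_contra hp
  have := (alternatingWord_append_singleton.1 (S.alternating _ h)).2.2 hp
  simp at this

theorem append_singleton_mem {p p' : S.Word} {m : S.Move} (hp' : p' ∈ S.P) (h : p ++ [m] <+: p') :
    p ++ [m] ∈ S.P :=
  S.prefix_mem _ hp' _ h (by simp)

theorem mem_P_of_append {p : S.Word} {m : S.Move} (h : p ++ [m] ∈ S.P) (hp : p ≠ []) : p ∈ S.P :=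
  S.prefix_mem _ h _ (List.prefix_append _ _) hp

theorem append_cell_mem_queries {p : S.Word} {c : S.C} (h : p ++ [Sum.inl c] ∈ S.P) :
    p ++ [Sum.inl c] ∈ S.queries := ⟨h, _, _, rfl⟩

theorem append_value_mem_responses {p : S.Word} {v : S.V} (h : p ++ [Sum.inr v] ∈ S.P) :
    p ++ [Sum.inr v] ∈ S.responses := ⟨h, _, _, rfl⟩

theorem mem_queries_of_append_value {p : S.Word} {v : S.V} (h : p ++ [Sum.inr v] ∈ S.P) :
    p ∈ S.queries := by
  have hc := endsCell_of_append_value h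
  refine ⟨mem_P_of_append h ?_, hc⟩
  rintro rfl
  simp at hc

/-- A position that properly extends `p` does so by a cell if `p` is empty or a response, and by a
value if `p` is a query. -/
theorem extend_by_cell {p p' : S.Word} (hp' : p' ∈ S.P) (h : p <+: p') (hne : p ≠ p')
    (hp : ¬ EndsCell p) : ∃ c, p ++ [Sum.inl c] <+: p' := by
  obtain ⟨m, hm⟩ := (eq_or_append_prefix h).resolve_left hne
  cases m with
  | inl c => exact ⟨c, hm⟩
  | inr v => exact absurd (endsCell_of_append_value (append_singleton_mem hp' hm)) hp

theorem extend_by_value {p p' : S.Word} (hp' : p' ∈ S.P) (h : p <+: p') (hne : p ≠ p')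
    (hp : EndsCell p) : ∃ v, p ++ [Sum.inr v] <+: p' := by
  obtain ⟨m, hm⟩ := (eq_or_append_prefix h).resolve_left hne
  cases m with
  | inl c => exact absurd hp (not_endsCell_of_append_cell (append_singleton_mem hp' hm))
  | inr v => exact ⟨v, hm⟩

theorem first_cell_mem {p : S.Word} (hp : p ∈ S.P) :
    ∃ c, [Sum.inl c] <+: p ∧ [Sum.inl c] ∈ S.queries := by
  obtain ⟨c, hc⟩ := extend_by_cell hp List.nil_prefix (S.ne_nil _ hp).symm not_endsCell_nil
  exact ⟨c, hc, append_cell_mem_queries (p := []) (append_singleton_mem hp hc)⟩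

namespace Strategy

theorem value_unique (x : Strategy S) {q : S.Word} {v₁ v₂ : S.V}
    (h₁ : q ++ [Sum.inr v₁] ∈ x.carrier) (h₂ : q ++ [Sum.inr v₂] ∈ x.carrier) : v₁ = v₂ := by
  by_contra hne
  have hc : EndsCell q := endsCell_of_append_value (x.subset_responses h₁).1
  have hmeet : IsMeet q (q ++ [Sum.inr v₁]) (q ++ [Sum.inr v₂]) := by
    refine ⟨List.prefix_append _ _, List.prefix_append _ _, fun w hw₁ hw₂ => ?_⟩
    rcases List.prefix_concat_iff.1 hw₁ with rfl | h
    · exact absurd (by simpa using hw₂) hne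
    · exact h
  have hq : q ≠ [] := by
    rintro rfl
    simp at hc
  exact (mem_responses_iff.1 (x.subset_responses (x.meet_mem _ h₁ _ h₂ _ hmeet hq))).2 hc

/-- A set of responses is a strategy as soon as it is closed under response prefixes and answers
each query with at most one value. -/
def ofUnique (X : Set S.Word) (hX : X ⊆ S.responses)
    (hpre : ∀ r ∈ X, ∀ t ∈ S.responses, t <+: r → t ∈ X)
    (huniq : ∀ q v₁ v₂, q ++ [Sum.inr v₁] ∈ X → q ++ [Sum.inr v₂] ∈ X → v₁ = v₂) : Strategy S where
  carrier := X
  subset_responses := hX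
  prefix_mem := hpre
  meet_mem := by
    rintro r₁ h₁ r₂ h₂ p ⟨hp₁, hp₂, hmax⟩ hne
    rcases eq_or_append_prefix hp₁ with rfl | ⟨m₁, hm₁⟩
    · exact h₁
    rcases eq_or_append_prefix hp₂ with rfl | ⟨m₂, hm₂⟩
    · exact h₂
    have hr₁ := (hX h₁).1
    have hr₂ := (hX h₂).1
    by_cases hc : EndsCell p
    · exfalso
      obtain ⟨v₁, hv₁⟩ := extend_by_value hr₁ hp₁
        (fun h => not_append_prefix_self (h ▸ hm₁ : p ++ [m₁] <+: p)) hc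
      obtain ⟨v₂, hv₂⟩ := extend_by_value hr₂ hp₂
        (fun h => not_append_prefix_self (h ▸ hm₂ : p ++ [m₂] <+: p)) hc
      have hv := huniq p v₁ v₂
        (hpre _ h₁ _ (append_value_mem_responses (append_singleton_mem hr₁ hv₁)) hv₁)
        (hpre _ h₂ _ (append_value_mem_responses (append_singleton_mem hr₂ hv₂)) hv₂)
      subst hv
      exact not_append_prefix_self (hmax _ hv₁ hv₂)
    · exact hpre _ h₁ _ (mem_responses_iff.2 ⟨S.prefix_mem _ hr₁ _ hp₁ hne, hc⟩) hp₁

end Strategy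

namespace CounterStrategy

theorem cell_unique (α : CounterStrategy S) {r : S.Word} {c₁ c₂ : S.C}
    (h₁ : r ++ [Sum.inl c₁] ∈ α.carrier) (h₂ : r ++ [Sum.inl c₂] ∈ α.carrier) : c₁ = c₂ := by
  by_contra hne
  have hmeet : IsMeet r (r ++ [Sum.inl c₁]) (r ++ [Sum.inl c₂]) := by
    refine ⟨List.prefix_append _ _, List.prefix_append _ _, fun w hw₁ hw₂ => ?_⟩
    rcases List.prefix_concat_iff.1 hw₁ with rfl | h
    · exact absurd (by simpa using hw₂) hne
    · exact h
  exact not_endsCell_of_append_cell (α.subset_queries h₁).1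
    (α.subset_queries (α.meet_mem _ h₁ _ h₂ _ hmeet)).2

/-- A non-empty set of queries is a counter-strategy as soon as it is closed under query prefixes
and follows each response, and the empty word, by at most one cell. -/
def ofUnique (X : Set S.Word) (hne : X.Nonempty) (hX : X ⊆ S.queries)
    (hpre : ∀ q ∈ X, ∀ t ∈ S.queries, t <+: q → t ∈ X)
    (huniq : ∀ r c₁ c₂, r ++ [Sum.inl c₁] ∈ X → r ++ [Sum.inl c₂] ∈ X → c₁ = c₂) :
    CounterStrategy S where
  carrier := X
  nonempty := hne
  subset_queries := hX
  prefix_mem := hpre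
  meet_mem := by
    rintro q₁ h₁ q₂ h₂ p ⟨hp₁, hp₂, hmax⟩
    rcases eq_or_append_prefix hp₁ with rfl | ⟨m₁, hm₁⟩
    · exact h₁
    rcases eq_or_append_prefix hp₂ with rfl | ⟨m₂, hm₂⟩
    · exact h₂
    have hq₁ := (hX h₁).1
    have hq₂ := (hX h₂).1
    by_cases hc : EndsCell p
    · refine hpre _ h₁ _ ⟨S.prefix_mem _ hq₁ _ hp₁ ?_, hc⟩ hp₁
      rintro rfl
      simp at hc
    · exfalso
      obtain ⟨c₁, hc₁⟩ := extend_by_cell hq₁ hp₁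
        (fun h => not_append_prefix_self (h ▸ hm₁ : p ++ [m₁] <+: p)) hc
      obtain ⟨c₂, hc₂⟩ := extend_by_cell hq₂ hp₂
        (fun h => not_append_prefix_self (h ▸ hm₂ : p ++ [m₂] <+: p)) hc
      have hcc := huniq p c₁ c₂
        (hpre _ h₁ _ (append_cell_mem_queries (append_singleton_mem hq₁ hc₁)) hc₁)
        (hpre _ h₂ _ (append_cell_mem_queries (append_singleton_mem hq₂ hc₂)) hc₂)
      subst hcc
      exact not_append_prefix_self (hmax _ hc₁ hc₂)

end CounterStrategy

/-- The strategy of all response prefixes of a word `p`. -/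
def below (p : S.Word) : Strategy S :=
  Strategy.ofUnique {t | t ∈ S.responses ∧ t <+: p} (fun _ h => h.1)
    (fun _ hr _ ht htr => ⟨ht, htr.trans hr.2⟩) (by
      rintro q v₁ v₂ ⟨-, h₁⟩ ⟨-, h₂⟩
      have := List.prefix_of_prefix_length_le h₁ h₂ (by simp)
      simpa using this)

/-- The counter-strategy of all query prefixes of a position `p`. -/
def counterBelow (p : S.Word) (hp : p ∈ S.P) : CounterStrategy S :=
  CounterStrategy.ofUnique {t | t ∈ S.queries ∧ t <+: p}
    (let ⟨_, hc, hq⟩ := first_cell_mem hp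
     ⟨_, hq, hc⟩)
    (fun _ h => h.1)
    (fun _ hq _ ht htq => ⟨ht, htq.trans hq.2⟩) (by
      rintro q v₁ v₂ ⟨-, h₁⟩ ⟨-, h₂⟩
      have := List.prefix_of_prefix_length_le h₁ h₂ (by simp)
      simpa using this)

theorem finite_prefixes {M : Type*} (p : List M) : {t | t <+: p}.Finite := by
  refine (p.inits.finite_toSet).subset fun t ht => ?_
  simpa using ht

theorem below_finite (p : S.Word) : (below p).carrier.Finite :=
  (finite_prefixes p).subset fun _ h => h.2

theorem counterBelow_finite (p : S.Word) (hp : p ∈ S.P) : (counterBelow p hp).carrier.Finite :=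
  (finite_prefixes p).subset fun _ h => h.2

theorem below_mono {p p' : S.Word} (h : p <+: p') : below p ≤ below p' :=
  fun _ ht => ⟨ht.1, ht.2.trans h⟩

/-- The word `p` is consistent with the strategy `x`: its response prefixes belong to `x`. -/
def Follows (x : Strategy S) (p : S.Word) : Prop := ∀ r ∈ S.responses, r <+: p → r ∈ x.carrier

/-- The word `p` is consistent with the counter-strategy `α`: its query prefixes belong to `α`. -/
def CounterFollows (α : CounterStrategy S) (p : S.Word) : Prop :=
  ∀ q ∈ S.queries, q <+: p → q ∈ α.carrier

theorem Follows.of_prefix {x : Strategy S} {p p' : S.Word} (h : Follows x p') (hp : p <+: p') :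
    Follows x p := fun r hr hrp => h r hr (hrp.trans hp)

theorem CounterFollows.of_prefix {α : CounterStrategy S} {p p' : S.Word}
    (h : CounterFollows α p') (hp : p <+: p') : CounterFollows α p :=
  fun q hq hqp => h q hq (hqp.trans hp)

theorem Follows.of_mem {x : Strategy S} {p : S.Word} (h : p ∈ x.carrier) : Follows x p :=
  fun _ hr hrp => x.prefix_mem _ h _ hr hrp

theorem CounterFollows.of_mem {α : CounterStrategy S} {p : S.Word} (h : p ∈ α.carrier) :
    CounterFollows α p :=
  fun _ hq hqp => α.prefix_mem _ h _ hq hqp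

theorem Follows.nil (x : Strategy S) : Follows x [] := fun _ hr hrp => by
  rw [List.prefix_nil] at hrp
  exact absurd hrp (S.ne_nil _ hr.1)

theorem CounterFollows.nil (α : CounterStrategy S) : CounterFollows α [] := fun _ hq hqp => by
  rw [List.prefix_nil] at hqp
  exact absurd hqp (S.ne_nil _ hq.1)

theorem Follows.of_nil_or_mem {x : Strategy S} {p : S.Word} (h : p = [] ∨ p ∈ x.carrier) :
    Follows x p := by
  rcases h with rfl | h
  · exact Follows.nil x
  · exact Follows.of_mem h

theorem Follows.append_cell {x : Strategy S} {p : S.Word} (h : Follows x p) (c : S.C) :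
    Follows x (p ++ [Sum.inl c]) := fun _ hr hrp => by
  rcases List.prefix_concat_iff.1 hrp with rfl | hrp
  · exact absurd (mem_responses_iff.1 hr).2 (by simp)
  · exact h _ hr hrp

theorem CounterFollows.append_value {α : CounterStrategy S} {p : S.Word} (h : CounterFollows α p)
    (v : S.V) : CounterFollows α (p ++ [Sum.inr v]) := fun _ hq hqp => by
  rcases List.prefix_concat_iff.1 hqp with rfl | hqp
  · exact absurd (mem_queries_iff.1 hq).2 (by simp)
  · exact h _ hq hqp

theorem follows_below (p : S.Word) : Follows (below p) p := fun _ hr hrp => ⟨hr, hrp⟩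

theorem counterFollows_counterBelow (p : S.Word) (hp : p ∈ S.P) :
    CounterFollows (counterBelow p hp) p := fun _ hq hqp => ⟨hq, hqp⟩

theorem Follows.mono {x y : Strategy S} (h : x ≤ y) {p : S.Word} (hp : Follows x p) : Follows y p :=
  fun r hr hrp => h (hp r hr hrp)

theorem Follows.below_le {x : Strategy S} {p : S.Word} (hp : Follows x p) : below p ≤ x :=
  fun r hr => hp r hr.1 hr.2

theorem CounterFollows.counterBelow_le {α : CounterStrategy S} {p : S.Word}
    (hα : CounterFollows α p) (hp : p ∈ S.P) : counterBelow p hp ≤ α :=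
  fun q hq => hα q hq.1 hq.2

/-- Words consistent with the same strategy and the same counter-strategy are comparable. -/
theorem prefix_or_prefix_of_follows {x : Strategy S} {α : CounterStrategy S} {p p' : S.Word}
    (hp : p ∈ S.P) (hp' : p' ∈ S.P) (hx : Follows x p) (hα : CounterFollows α p)
    (hx' : Follows x p') (hα' : CounterFollows α p') : p <+: p' ∨ p' <+: p := by
  rcases prefix_or_fork p p' with h | h | ⟨w, m, n, hmn, h₁, h₂⟩
  · exact Or.inl h
  · exact Or.inr h
  have hm := append_singleton_mem hp h₁
  have hn := append_singleton_mem hp' h₂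
  cases m with
  | inl c =>
    cases n with
    | inl d =>
      exact absurd (congrArg Sum.inl (α.cell_unique
        (hα _ (append_cell_mem_queries hm) h₁) (hα' _ (append_cell_mem_queries hn) h₂))) hmn
    | inr v => exact absurd (endsCell_of_append_value hn) (not_endsCell_of_append_cell hm)
  | inr v =>
    cases n with
    | inl d => exact absurd (endsCell_of_append_value hm) (not_endsCell_of_append_cell hn)
    | inr v' =>
      exact absurd (congrArg Sum.inr (x.value_unique
        (hx _ (append_value_mem_responses hm) h₁) (hx' _ (append_value_mem_responses hn) h₂))) hmn

/-! ### Plays -/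

theorem isPlay_response_iff {x : Strategy S} {α : CounterStrategy S} {r : S.Word}
    (hr : r ∈ S.responses) :
    IsPlay x α r ↔ r ∈ x.carrier ∧ CounterFollows α r ∧ ∀ c, r ++ [Sum.inl c] ∉ α.carrier := by
  constructor
  · rintro ⟨⟨hP, hx, hα⟩, hmax⟩
    refine ⟨hx r hr List.prefix_rfl, hα, fun c hc => ?_⟩
    refine not_append_prefix_self (hmax (r ++ [Sum.inl c]) ⟨(α.subset_queries hc).1, ?_, ?_⟩)
    · exact Follows.append_cell (x := x) hx c
    · exact CounterFollows.of_mem hc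
  · rintro ⟨hx, hα, hmax⟩
    refine ⟨⟨hr.1, Follows.of_mem hx, hα⟩, fun p' hp' => ?_⟩
    rcases prefix_or_prefix_of_follows hr.1 hp'.1 (Follows.of_mem hx) hα hp'.2.1 hp'.2.2 with h | h
    · by_cases hne : r = p'
      · exact hne ▸ List.prefix_rfl
      obtain ⟨c, hc⟩ := extend_by_cell hp'.1 h hne (mem_responses_iff.1 hr).2
      exact absurd
        (hp'.2.2 _ (append_cell_mem_queries (append_singleton_mem hp'.1 hc)) hc) (hmax c)
    · exact h

theorem isPlay_query_iff {x : Strategy S} {α : CounterStrategy S} {q : S.Word}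
    (hq : q ∈ S.queries) :
    IsPlay x α q ↔ q ∈ α.carrier ∧ Follows x q ∧ ∀ v, q ++ [Sum.inr v] ∉ x.carrier := by
  constructor
  · rintro ⟨⟨hP, hx, hα⟩, hmax⟩
    refine ⟨hα q hq List.prefix_rfl, hx, fun v hv => ?_⟩
    refine not_append_prefix_self (hmax (q ++ [Sum.inr v]) ⟨(x.subset_responses hv).1, ?_, ?_⟩)
    · exact Follows.of_mem hv
    · exact CounterFollows.append_value (α := α) hα v
  · rintro ⟨hα, hx, hmax⟩
    refine ⟨⟨hq.1, hx, CounterFollows.of_mem hα⟩, fun p' hp' => ?_⟩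
    rcases prefix_or_prefix_of_follows hq.1 hp'.1 hx (CounterFollows.of_mem hα) hp'.2.1 hp'.2.2
      with h | h
    · by_cases hne : q = p'
      · exact hne ▸ List.prefix_rfl
      obtain ⟨v, hv⟩ := extend_by_value hp'.1 h hne hq.2
      exact absurd
        (hp'.2.1 _ (append_value_mem_responses (append_singleton_mem hp'.1 hv)) hv) (hmax v)
    · exact h

theorem IsPlay.unique {x : Strategy S} {α : CounterStrategy S} {p p' : S.Word}
    (h : IsPlay x α p) (h' : IsPlay x α p') : p = p' :=
  prefix_antisymm (h'.2 _ h.1) (h.2 _ h'.1)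

theorem not_wins_and_loses {x : Strategy S} {α : CounterStrategy S} (h : Wins x α)
    (h' : Loses x α) : False := by
  obtain ⟨r, hr, h⟩ := h
  obtain ⟨q, hq, h'⟩ := h'
  obtain rfl := h.unique h'
  exact (mem_responses_iff.1 hr).2 hq.2

/-- A response of `x` wins against the counter-strategy of its own query prefixes. -/
theorem isPlay_counterBelow {x : Strategy S} {q : S.Word} {v : S.V} (hq : q ∈ S.P)
    (h : q ++ [Sum.inr v] ∈ x.carrier) : IsPlay x (counterBelow q hq) (q ++ [Sum.inr v]) := by
  refine (isPlay_response_iff (x.subset_responses h)).2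
    ⟨h, (counterFollows_counterBelow q hq).append_value v, fun c hc => ?_⟩
  have := hc.2.length_le
  simp at this

/-- A query of `α` wins against the strategy of its own response prefixes. -/
theorem isPlay_below {α : CounterStrategy S} {r : S.Word} {c : S.C}
    (h : r ++ [Sum.inl c] ∈ α.carrier) : IsPlay (below r) α (r ++ [Sum.inl c]) := by
  refine (isPlay_query_iff (α.subset_queries h)).2
    ⟨h, (follows_below r).append_cell c, fun v hv => ?_⟩
  have := hv.2.length_le
  simp at this

theorem wins_counterBelow_iff {x y : Strategy S} {q : S.Word} {v : S.V} (hq : q ∈ S.P) (hyx : y ≤ x)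
    (h : q ++ [Sum.inr v] ∈ x.carrier) :
    Wins y (counterBelow q hq) ↔ q ++ [Sum.inr v] ∈ y.carrier := by
  constructor
  · rintro ⟨r, hr, hplay⟩
    obtain ⟨h₁, h₂, h₃⟩ := (isPlay_response_iff hr).1 hplay
    have hr' : IsPlay x (counterBelow q hq) r := (isPlay_response_iff hr).2 ⟨hyx h₁, h₂, h₃⟩
    rwa [(isPlay_counterBelow hq h).unique hr']
  · intro h
    exact ⟨_, y.subset_responses h, isPlay_counterBelow hq h⟩

theorem loses_below_iff {α β : CounterStrategy S} {r : S.Word} {c : S.C} (hβα : β ≤ α)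
    (h : r ++ [Sum.inl c] ∈ α.carrier) :
    Loses (below r) β ↔ r ++ [Sum.inl c] ∈ β.carrier := by
  constructor
  · rintro ⟨q, hq, hplay⟩
    obtain ⟨h₁, h₂, h₃⟩ := (isPlay_query_iff hq).1 hplay
    have hq' : IsPlay (below r) α q := (isPlay_query_iff hq).2 ⟨hβα h₁, h₂, h₃⟩
    rwa [(isPlay_below h).unique hq']
  · intro h
    exact ⟨_, β.subset_queries h, isPlay_below h⟩

theorem mem_partialCarrier_coe {α : CounterStrategy S} {q : S.Word} :
    q ∈ partialCarrier (α : WithBot (CounterStrategy S)) ↔ q ∈ α.carrier := by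
  constructor
  · rintro ⟨β, hβ, hq⟩
    rwa [WithBot.coe_injective hβ]
  · exact fun h => ⟨α, rfl, h⟩

theorem not_mem_partialCarrier_bot {q : S.Word} :
    q ∉ partialCarrier (⊥ : WithBot (CounterStrategy S)) := by
  rintro ⟨β, hβ, -⟩
  exact WithBot.bot_ne_coe hβ

/-- The order on possibly undefined counter-strategies is the inclusion of underlying sets, because
a counter-strategy is non-empty. -/
theorem partialCarrier_subset_iff {a b : WithBot (CounterStrategy S)} :
    partialCarrier a ⊆ partialCarrier b ↔ a ≤ b := by
  cases a with
  | bot => simp only [bot_le, iff_true]; exact fun q hq => absurd hq not_mem_partialCarrier_bot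
  | coe α =>
    cases b with
    | bot =>
      constructor
      · intro h
        obtain ⟨q, hq⟩ := α.nonempty
        exact absurd (h (mem_partialCarrier_coe.2 hq)) not_mem_partialCarrier_bot
      · intro h
        simp at h
    | coe β =>
      rw [WithBot.coe_le_coe]
      exact ⟨fun h q hq => mem_partialCarrier_coe.1 (h (mem_partialCarrier_coe.2 hq)),
        fun h q hq => mem_partialCarrier_coe.2 (h (mem_partialCarrier_coe.1 hq))⟩

theorem partialCarrier_injective {a b : WithBot (CounterStrategy S)}
    (h : partialCarrier a = partialCarrier b) : a = b :=
  le_antisymm (partialCarrier_subset_iff.1 h.subset) (partialCarrier_subset_iff.1 h.superset)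

end Basic

/-! ### Positions of the affine arrow -/

section Arrow

variable {S S' : SDS.{u}}

@[simp] theorem projIn_nil : projIn ([] : ArrowWord S S') = [] := rfl
@[simp] theorem projOut_nil : projOut ([] : ArrowWord S S') = [] := rfl

@[simp] theorem projIn_request (s : ArrowWord S S') (c' : S'.C) :
    projIn (s ++ [request c']) = projIn s := by simp [projIn, inMove]

@[simp] theorem projIn_is (s : ArrowWord S S') (v : S.V) :
    projIn (s ++ [is v]) = projIn s ++ [Sum.inr v] := by simp [projIn, inMove]

@[simp] theorem projIn_output (s : ArrowWord S S') (v' : S'.V) :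
    projIn (s ++ [output v']) = projIn s := by simp [projIn, inMove]

@[simp] theorem projIn_valof (s : ArrowWord S S') (c : S.C) :
    projIn (s ++ [valof c]) = projIn s ++ [Sum.inl c] := by simp [projIn, inMove]

@[simp] theorem projOut_request (s : ArrowWord S S') (c' : S'.C) :
    projOut (s ++ [request c']) = projOut s ++ [Sum.inl c'] := by simp [projOut, outMove]

@[simp] theorem projOut_is (s : ArrowWord S S') (v : S.V) :
    projOut (s ++ [is v]) = projOut s := by simp [projOut, outMove]

@[simp] theorem projOut_output (s : ArrowWord S S') (v' : S'.V) :
    projOut (s ++ [output v']) = projOut s ++ [Sum.inr v'] := by simp [projOut, outMove]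

@[simp] theorem projOut_valof (s : ArrowWord S S') (c : S.C) :
    projOut (s ++ [valof c]) = projOut s := by simp [projOut, outMove]

theorem projIn_prefix {s t : ArrowWord S S'} (h : s <+: t) : projIn s <+: projIn t :=
  h.filterMap _

theorem projOut_prefix {s t : ArrowWord S S'} (h : s <+: t) : projOut s <+: projOut t :=
  h.filterMap _

theorem length_projIn_add_length_projOut (s : ArrowWord S S') :
    (projIn s).length + (projOut s).length = s.length := by
  induction s using List.reverseRecOn with
  | nil => rfl
  | append_singleton s m ih =>
    rcases m with (c' | v) | (v' | c) <;> simp <;> omega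

/-- A move of the input sds in the projection of a word comes from a prefix of that word ending with
the corresponding move. -/
theorem exists_prefix_valof {s : ArrowWord S S'} {w : S.Word} {c : S.C}
    (h : w ++ [Sum.inl c] <+: projIn s) : ∃ t, t ++ [valof c] <+: s ∧ projIn t = w := by
  obtain ⟨k, m, h₁, h₂, h₃⟩ := exists_append_prefix_of_filterMap h
  rcases m with (c' | v) | (v' | d) <;> simp [inMove] at h₃
  subst h₃
  exact ⟨k, h₁, h₂⟩

theorem exists_prefix_output {s : ArrowWord S S'} {w : S'.Word} {v' : S'.V}
    (h : w ++ [Sum.inr v'] <+: projOut s) : ∃ t, t ++ [output v'] <+: s ∧ projOut t = w := by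
  obtain ⟨k, m, h₁, h₂, h₃⟩ := exists_append_prefix_of_filterMap h
  rcases m with (c' | v) | (d | c) <;> simp [outMove] at h₃
  subst h₃
  exact ⟨k, h₁, h₂⟩

theorem forbidden_append_singleton {s : ArrowWord S S'} {m : ArrowMove S S'} :
    (∃ (w : ArrowWord S S') (c : S.C) (c' : S'.C), w ++ [valof c, request c'] <+: s ++ [m]) ↔
      (∃ (w : ArrowWord S S') (c : S.C) (c' : S'.C), w ++ [valof c, request c'] <+: s) ∨
      ∃ (w : ArrowWord S S') (c : S.C) (c' : S'.C), s = w ++ [valof c] ∧ m = request c' := by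
  constructor
  · rintro ⟨w, c, c', h⟩
    rcases List.prefix_concat_iff.1 h with h | h
    · right
      have h' : (w ++ [valof c]) ++ [request c'] = s ++ [m] := by simpa using h
      obtain ⟨h₁, h₂⟩ := List.append_inj' h' rfl
      exact ⟨w, c, c', h₁.symm, by simpa using h₂.symm⟩
    · exact Or.inl ⟨w, c, c', h⟩
  · rintro (⟨w, c, c', h⟩ | ⟨w, c, c', rfl, rfl⟩)
    · exact ⟨w, c, c', h.trans (List.prefix_append _ _)⟩
    · exact ⟨w, c, c', by simp⟩

theorem not_forbidden {s : ArrowWord S S'} (h : s ∈ (lolli S S').P) {w : ArrowWord S S'} {c : S.C}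
    {c' : S'.C} : ¬ w ++ [valof c, request c'] <+: s :=
  fun hw => h.2.2.2.2 ⟨w, c, c', hw⟩

theorem head?_append_of_ne_nil {M : Type*} {s : List M} (hs : s ≠ []) (m : M) :
    (s ++ [m]).head? = s.head? := by
  cases s with
  | nil => exact absurd rfl hs
  | cons a s => rfl

theorem append_output_mem {s : ArrowWord S S'} (hs : s ∈ (lolli S S').P) (hc : EndsCell s)
    {v' : S'.V} (h : projOut s ++ [Sum.inr v'] ∈ S'.P) : s ++ [output v'] ∈ (lolli S S').P := by
  obtain ⟨h₁, ⟨c', h₂⟩, h₃, h₄, h₅⟩ := hs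
  have hne : s ≠ [] := by rintro rfl; simp at h₂
  refine ⟨alternatingWord_append_singleton.2 ⟨h₁, by simp [hc]⟩,
    ⟨c', by rw [head?_append_of_ne_nil hne, h₂]⟩, by simpa using h, by simpa using h₄, ?_⟩
  rw [forbidden_append_singleton]
  rintro (h | ⟨w, c, c', -, h⟩)
  · exact h₅ h
  · cases h

theorem append_valof_mem {s : ArrowWord S S'} (hs : s ∈ (lolli S S').P) (hc : EndsCell s)
    {c : S.C} (h : projIn s ++ [Sum.inl c] ∈ S.P) : s ++ [valof c] ∈ (lolli S S').P := by
  obtain ⟨h₁, ⟨c', h₂⟩, h₃, h₄, h₅⟩ := hs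
  have hne : s ≠ [] := by rintro rfl; simp at h₂
  refine ⟨alternatingWord_append_singleton.2 ⟨h₁, by simp [hc]⟩,
    ⟨c', by rw [head?_append_of_ne_nil hne, h₂]⟩, by simpa using h₃, Or.inr (by simpa using h), ?_⟩
  rw [forbidden_append_singleton]
  rintro (h | ⟨w, c, c', -, h⟩)
  · exact h₅ h
  · cases h

theorem append_is_mem {s : ArrowWord S S'} (hs : s ∈ (lolli S S').P) (hc : ¬ EndsCell s)
    {v : S.V} (h : projIn s ++ [Sum.inr v] ∈ S.P) : s ++ [is v] ∈ (lolli S S').P := by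
  obtain ⟨h₁, ⟨c', h₂⟩, h₃, h₄, h₅⟩ := hs
  have hne : s ≠ [] := by rintro rfl; simp at h₂
  refine ⟨alternatingWord_append_singleton.2 ⟨h₁, by simp [hc]⟩,
    ⟨c', by rw [head?_append_of_ne_nil hne, h₂]⟩, by simpa using h₃, Or.inr (by simpa using h), ?_⟩
  rw [forbidden_append_singleton]
  rintro (h | ⟨w, c, c', -, h⟩)
  · exact h₅ h
  · cases h

theorem append_request_mem {s : ArrowWord S S'} (hs : s = [] ∨ s ∈ (lolli S S').P)
    (hc : ¬ EndsCell s) (hin : ¬ EndsCell (projIn s)) {c' : S'.C}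
    (h : projOut s ++ [Sum.inl c'] ∈ S'.P) : s ++ [request c'] ∈ (lolli S S').P := by
  rcases hs with rfl | ⟨h₁, ⟨d', h₂⟩, h₃, h₄, h₅⟩
  · refine ⟨alternatingWord_append_singleton.2 ⟨alternatingWord_nil, by simp⟩, ⟨c', rfl⟩,
      by simpa [projOut, outMove] using h, by simp [projIn, inMove], ?_⟩
    rw [forbidden_append_singleton]
    rintro (⟨w, c, c', h⟩ | ⟨w, c, c', h, -⟩)
    · simp at h
    · simp at h
  have hne : s ≠ [] := by rintro rfl; simp at h₂
  refine ⟨alternatingWord_append_singleton.2 ⟨h₁, by simp [hc]⟩,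
    ⟨d', by rw [head?_append_of_ne_nil hne, h₂]⟩, by simpa using h, by simpa using h₄, ?_⟩
  rw [forbidden_append_singleton]
  rintro (h | ⟨w, c, c', rfl, -⟩)
  · exact h₅ h
  · simp at hin

theorem projOut_mem {s : ArrowWord S S'} (hs : s ∈ (lolli S S').P) : projOut s ∈ S'.P := hs.2.2.1

theorem projIn_mem {s : ArrowWord S S'} (hs : s ∈ (lolli S S').P) :
    projIn s = [] ∨ projIn s ∈ S.P := hs.2.2.2.1

theorem projIn_mem_of_append {s : ArrowWord S S'} {m : S.Move} {w : S.Word}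
    (hs : s ∈ (lolli S S').P) (h : w ++ [m] <+: projIn s) : w ++ [m] ∈ S.P := by
  refine append_singleton_mem ((projIn_mem hs).resolve_left fun h0 => ?_) h
  rw [h0] at h
  simp at h

/-- The projections of a position end according to its last move: after `output` both end
with values (the input one may be empty), after `valof` both end with cells, and after a cell the
input projection does not end with a cell while the output projection does. -/
theorem endsCell_proj {s : ArrowWord S S'} (hs : s ∈ (lolli S S').P) :
    (EndsCell s → ¬ EndsCell (projIn s) ∧ EndsCell (projOut s)) ∧
    (∀ t v', s = t ++ [output v'] → ¬ EndsCell (projIn s) ∧ ¬ EndsCell (projOut s)) ∧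
    (∀ t c, s = t ++ [valof c] → EndsCell (projIn s) ∧ EndsCell (projOut s)) := by
  induction s using List.reverseRecOn with
  | nil => exact absurd rfl ((lolli S S').ne_nil _ hs)
  | append_singleton s m ih =>
    by_cases hne : s = []
    · subst hne
      obtain ⟨c', hc'⟩ := hs.2.1
      obtain rfl : m = request c' := by simpa using hc'
      refine ⟨fun _ => by rw [projIn_request, projOut_request]; simp,
        fun t v' h => ?_, fun t c h => ?_⟩
      · have := (List.append_inj' h rfl).2
        simp at this
      · have := (List.append_inj' h rfl).2
        simp at this
    have hsP : s ∈ (lolli S S').P := mem_P_of_append hs hne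
    obtain ⟨ih₁, ih₂, ih₃⟩ := ih hsP
    rcases m with (c' | v) | (v' | c)
    · have hnc := not_endsCell_of_append_cell hs
      obtain ⟨t, w, ht⟩ := ends_value_of_not_endsCell hne hnc
      rcases w with v' | c
      · have := ih₂ t v' ht
        simpa using this.1
      · exact absurd (by simp [ht]) (not_forbidden hs (w := t) (c := c) (c' := c'))
    · have hnc := not_endsCell_of_append_cell hs
      obtain ⟨t, w, ht⟩ := ends_value_of_not_endsCell hne hnc
      rcases w with v' | c
      · have h' := (ih₂ t v' ht).1
        have := projIn_mem_of_append (w := projIn s) (m := Sum.inr v) hs (by simp)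
        exact absurd (endsCell_of_append_value this) h'
      · have := ih₃ t c ht
        simpa using this.2
    · have := ih₁ (endsCell_of_append_value hs)
      simpa using this.1
    · have := ih₁ (endsCell_of_append_value hs)
      simpa using this.2

theorem not_endsCell_projIn {s : ArrowWord S S'} (hs : s ∈ (lolli S S').P) (h : EndsCell s) :
    ¬ EndsCell (projIn s) := ((endsCell_proj hs).1 h).1

theorem endsCell_projOut {s : ArrowWord S S'} (hs : s ∈ (lolli S S').P) (h : EndsCell s) :
    EndsCell (projOut s) := ((endsCell_proj hs).1 h).2

theorem not_endsCell_projIn_of_append_output {s : ArrowWord S S'} {v' : S'.V}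
    (hs : s ++ [output v'] ∈ (lolli S S').P) : ¬ EndsCell (projIn s) := by
  have := ((endsCell_proj hs).2.1 s v' rfl).1
  simpa using this

theorem endsCell_projOut_of_append_valof {s : ArrowWord S S'} {c : S.C}
    (hs : s ++ [valof c] ∈ (lolli S S').P) : EndsCell (projOut s) := by
  have := ((endsCell_proj hs).2.2 s c rfl).2
  simpa using this

/-- A response of the arrow is an `output` or a `valof`, and this can be read off either
projection. -/
theorem response_cases {s : ArrowWord S S'} (hs : s ∈ (lolli S S').responses) :
    (∃ t v', s = t ++ [output v'] ∧ ¬ EndsCell (projIn s) ∧ ¬ EndsCell (projOut s)) ∨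
    ∃ t c, s = t ++ [valof c] ∧ EndsCell (projIn s) ∧ EndsCell (projOut s) := by
  obtain ⟨hP, t, m, rfl⟩ := hs
  rcases m with v' | c
  · exact Or.inl ⟨t, v', rfl, (endsCell_proj hP).2.1 t v' rfl⟩
  · exact Or.inr ⟨t, c, rfl, (endsCell_proj hP).2.2 t c rfl⟩

theorem endsCell_projIn_iff {s : ArrowWord S S'} (hs : s ∈ (lolli S S').responses) :
    EndsCell (projIn s) ↔ EndsCell (projOut s) := by
  rcases response_cases hs with ⟨-, -, -, h⟩ | ⟨-, -, -, h⟩ <;> tauto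

theorem exists_output {s : ArrowWord S S'} (hs : s ∈ (lolli S S').responses)
    (h : ¬ EndsCell (projIn s)) : ∃ t v', s = t ++ [output v'] := by
  rcases response_cases hs with ⟨t, v', h', -⟩ | ⟨-, -, -, h', -⟩
  · exact ⟨t, v', h'⟩
  · exact absurd h' h

theorem exists_valof {s : ArrowWord S S'} (hs : s ∈ (lolli S S').responses)
    (h : EndsCell (projOut s)) : ∃ t c, s = t ++ [valof c] := by
  rcases response_cases hs with ⟨-, -, -, -, h'⟩ | ⟨t, c, h', -⟩
  · exact absurd h h'
  · exact ⟨t, c, h'⟩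

/-- After an `output`, a position continues with a `request`. -/
theorem extend_by_request {s t : ArrowWord S S'} {v' : S'.V} (ht : t ∈ (lolli S S').P)
    (h : s ++ [output v'] <+: t) (hne : s ++ [output v'] ≠ t) :
    ∃ c', s ++ [output v'] ++ [request c'] <+: t := by
  obtain ⟨m, hm⟩ := extend_by_cell ht h hne (by simp)
  rcases m with c' | v
  · exact ⟨c', hm⟩
  · have hP : s ++ [output v'] ++ [is v] ∈ (lolli S S').P := append_singleton_mem ht hm
    have := projIn_mem_of_append (w := projIn s) (m := Sum.inr v) hP
      (by rw [projIn_is, projIn_output])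
    exact absurd (endsCell_of_append_value this)
      (not_endsCell_projIn_of_append_output (mem_P_of_append hP (by simp)))

/-- After a `valof`, a position continues with an `is`. -/
theorem extend_by_is {s t : ArrowWord S S'} {c : S.C} (ht : t ∈ (lolli S S').P)
    (h : s ++ [valof c] <+: t) (hne : s ++ [valof c] ≠ t) :
    ∃ v, s ++ [valof c] ++ [is v] <+: t := by
  obtain ⟨m, hm⟩ := extend_by_cell ht h hne (by simp)
  rcases m with c' | v
  · exact absurd (by simpa using hm) (not_forbidden ht (w := s) (c := c) (c' := c'))
  · exact ⟨v, hm⟩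

theorem projOut_mem_responses {s : ArrowWord S S'} {v' : S'.V}
    (hs : s ++ [output v'] ∈ (lolli S S').P) : projOut s ++ [Sum.inr v'] ∈ S'.responses := by
  have := projOut_mem hs
  rw [projOut_output] at this
  exact append_value_mem_responses this

theorem projIn_mem_queries {s : ArrowWord S S'} {c : S.C}
    (hs : s ++ [valof c] ∈ (lolli S S').P) : projIn s ++ [Sum.inl c] ∈ S.queries :=
  append_cell_mem_queries (projIn_mem_of_append (w := projIn s) (m := Sum.inl c) hs (by simp))

theorem projOut_mem_queries {s : ArrowWord S S'} (hs : s ∈ (lolli S S').P) (hc : EndsCell s) :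
    projOut s ∈ S'.queries := ⟨projOut_mem hs, endsCell_projOut hs hc⟩

theorem projIn_nil_or_mem_responses {s : ArrowWord S S'} (hs : s ∈ (lolli S S').P)
    (h : ¬ EndsCell (projIn s)) : projIn s = [] ∨ projIn s ∈ S.responses :=
  (projIn_mem hs).imp id fun hP => mem_responses_iff.2 ⟨hP, h⟩

theorem nil_or_mem_iff_follows {s : ArrowWord S S'} (hs : s ∈ (lolli S S').P)
    (h : ¬ EndsCell (projIn s)) {x : Strategy S} :
    (projIn s = [] ∨ projIn s ∈ x.carrier) ↔ Follows x (projIn s) := by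
  refine ⟨Follows.of_nil_or_mem, fun hx => ?_⟩
  exact (projIn_nil_or_mem_responses hs h).imp id fun hr => hx _ hr List.prefix_rfl

/-- Elements of an affine algorithm whose projections are consistent with the same strategy and the
same counter-strategy are comparable: the algorithm itself never chooses between two moves, a fork
at an `is` would be a fork of the strategy, and a fork at a `request` one of the
counter-strategy. -/
theorem prefix_or_prefix_of_mem {φ : Strategy (lolli S S')} {x : Strategy S}
    {α' : CounterStrategy S'} {s t : ArrowWord S S'} (hs : s ∈ φ.carrier) (ht : t ∈ φ.carrier)
    (hsx : Follows x (projIn s)) (htx : Follows x (projIn t))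
    (hsα : CounterFollows α' (projOut s)) (htα : CounterFollows α' (projOut t)) :
    s <+: t ∨ t <+: s := by
  rcases prefix_or_fork s t with h | h | ⟨w, m, n, hmn, h₁, h₂⟩
  · exact Or.inl h
  · exact Or.inr h
  exfalso
  have hsP := (φ.subset_responses hs).1
  have htP := (φ.subset_responses ht).1
  have hm : w ++ [m] ∈ (lolli S S').P := append_singleton_mem hsP h₁
  have hn : w ++ [n] ∈ (lolli S S').P := append_singleton_mem htP h₂
  rcases m with m | m
  · have hw := not_endsCell_of_append_cell hm
    rcases n with n | n
    · by_cases hin : EndsCell (projIn w)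
      · -- After a `valof`, both words continue with an `is`.
        rcases m with c₁ | v₁
        · have := not_endsCell_projIn hm (by simp)
          simp [hin] at this
        rcases n with c₂ | v₂
        · have := not_endsCell_projIn hn (by simp)
          simp [hin] at this
        have hmP := projIn_mem_of_append (w := projIn w) (m := Sum.inr v₁) hm (by simp)
        have hnP := projIn_mem_of_append (w := projIn w) (m := Sum.inr v₂) hn (by simp)
        have := x.value_unique
          (hsx _ (append_value_mem_responses hmP) (by simpa using projIn_prefix h₁))
          (htx _ (append_value_mem_responses hnP) (by simpa using projIn_prefix h₂))
        exact hmn (by rw [this])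
      · -- Otherwise both words continue with a `request`.
        rcases m with c₁ | v₁
        swap
        · exact hin (endsCell_of_append_value
            (projIn_mem_of_append (w := projIn w) (m := Sum.inr v₁) hm (by simp)))
        rcases n with c₂ | v₂
        swap
        · exact hin (endsCell_of_append_value
            (projIn_mem_of_append (w := projIn w) (m := Sum.inr v₂) hn (by simp)))
        have hmP := projOut_mem hm
        have hnP := projOut_mem hn
        rw [projOut_request] at hmP hnP
        have := α'.cell_unique
          (hsα _ (append_cell_mem_queries hmP) (by simpa using projOut_prefix h₁))
          (htα _ (append_cell_mem_queries hnP) (by simpa using projOut_prefix h₂))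
        exact hmn (by rw [this])
    · exact hw (endsCell_of_append_value hn)
  · rcases n with n | n
    · exact not_endsCell_of_append_cell hn (endsCell_of_append_value hm)
    · have := φ.value_unique
        (φ.prefix_mem _ hs _ (append_value_mem_responses hm) h₁)
        (φ.prefix_mem _ ht _ (append_value_mem_responses hn) h₂)
      exact hmn (by rw [this])

end Arrow

/-! ### The symmetric algorithm of an affine algorithm -/

section ToSymmetric

variable {S S' : SDS.{u}}

/-- Only the elements of `φ` that end with an `output` contribute to `f_φ`: after a `valof`, the
input projection is a query. -/
theorem mem_applyFun_iff {φ : Strategy (lolli S S')} {x : Strategy S} {r' : S'.Word} :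
    r' ∈ applyFun φ x ↔ ∃ t v', t ++ [output v'] ∈ φ.carrier ∧ r' = projOut t ++ [Sum.inr v'] ∧
      Follows x (projIn t) := by
  constructor
  · rintro ⟨s, hs, rfl, hx⟩
    have hr := φ.subset_responses hs
    have hc : ¬ EndsCell (projIn s) := by
      rcases hx with hx | hx
      · simp [hx]
      · exact (mem_responses_iff.1 (x.subset_responses hx)).2
    obtain ⟨t, v', rfl⟩ := exists_output hr hc
    exact ⟨t, v', hs, by simp, by simpa using Follows.of_nil_or_mem hx⟩
  · rintro ⟨t, v', hs, rfl, hx⟩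
    have hP := (φ.subset_responses hs).1
    refine ⟨_, hs, by simp, (nil_or_mem_iff_follows hP ?_).2 (by simpa using hx)⟩
    simpa using not_endsCell_projIn_of_append_output hP

/-- Only the elements of `φ` that end with a `valof` contribute to `g_φ`: after an `output`, the
output projection is a response. -/
theorem mem_applyCounter_iff {φ : Strategy (lolli S S')} {α' : CounterStrategy S'} {q : S.Word} :
    q ∈ applyCounter φ α' ↔ ∃ t c, t ++ [valof c] ∈ φ.carrier ∧ q = projIn t ++ [Sum.inl c] ∧
      CounterFollows α' (projOut t) := by
  constructor
  · rintro ⟨s, hs, rfl, hα⟩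
    obtain ⟨t, c, rfl⟩ := exists_valof (φ.subset_responses hs) (α'.subset_queries hα).2
    exact ⟨t, c, hs, by simp, by simpa using CounterFollows.of_mem hα⟩
  · rintro ⟨t, c, hs, rfl, hα⟩
    have hP := (φ.subset_responses hs).1
    refine ⟨_, hs, by simp, ?_⟩
    rw [projOut_valof]
    have := projOut_mem hP
    rw [projOut_valof] at this
    exact hα _ ⟨this, endsCell_projOut_of_append_valof hP⟩ List.prefix_rfl

theorem follows_projIn_valof {x : Strategy S} {t : ArrowWord S S'} {c : S.C}
    (h : Follows x (projIn t)) : Follows x (projIn (t ++ [valof c])) := by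
  rw [projIn_valof]
  exact h.append_cell c

theorem follows_projIn_output {x : Strategy S} {t : ArrowWord S S'} {v' : S'.V}
    (h : Follows x (projIn t)) : Follows x (projIn (t ++ [output v'])) := by
  rwa [projIn_output]

theorem counterFollows_projOut_output {α' : CounterStrategy S'} {t : ArrowWord S S'} {v' : S'.V}
    (h : CounterFollows α' (projOut t)) : CounterFollows α' (projOut (t ++ [output v'])) := by
  rw [projOut_output]
  exact h.append_value v'

theorem counterFollows_projOut_valof {α' : CounterStrategy S'} {t : ArrowWord S S'} {c : S.C}
    (h : CounterFollows α' (projOut t)) : CounterFollows α' (projOut (t ++ [valof c])) := by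
  rwa [projOut_valof]

/-- In the interaction of an affine algorithm with `x` and `α'`, nothing follows an output that `α'`
does not pursue. -/
theorem prefix_of_final_output {φ : Strategy (lolli S S')} {x : Strategy S}
    {α' : CounterStrategy S'} {t s : ArrowWord S S'} {v' : S'.V}
    (ht : t ++ [output v'] ∈ φ.carrier) (htx : Follows x (projIn t))
    (htα : CounterFollows α' (projOut t))
    (hfin : ∀ c', projOut t ++ [Sum.inr v'] ++ [Sum.inl c'] ∉ α'.carrier)
    (hs : s ∈ φ.carrier) (hsx : Follows x (projIn s)) (hsα : CounterFollows α' (projOut s)) :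
    s <+: t ++ [output v'] := by
  rcases prefix_or_prefix_of_mem ht hs (follows_projIn_output htx) hsx
    (counterFollows_projOut_output htα) hsα with h | h
  · by_cases hne : t ++ [output v'] = s
    · exact hne ▸ List.prefix_rfl
    have hsP := (φ.subset_responses hs).1
    obtain ⟨c', hc'⟩ := extend_by_request hsP h hne
    have hP := projOut_mem (append_singleton_mem hsP hc')
    have hpre := projOut_prefix hc'
    rw [projOut_request, projOut_output] at hP hpre
    exact absurd (hsα _ (append_cell_mem_queries hP) hpre) (hfin c')
  · exact h

/-- In the interaction of an affine algorithm with `x` and `α'`, nothing follows a `valof` that `x`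
does not answer. -/
theorem prefix_of_final_valof {φ : Strategy (lolli S S')} {x : Strategy S}
    {α' : CounterStrategy S'} {t s : ArrowWord S S'} {c : S.C}
    (ht : t ++ [valof c] ∈ φ.carrier) (htx : Follows x (projIn t))
    (htα : CounterFollows α' (projOut t))
    (hfin : ∀ v, projIn t ++ [Sum.inl c] ++ [Sum.inr v] ∉ x.carrier)
    (hs : s ∈ φ.carrier) (hsx : Follows x (projIn s)) (hsα : CounterFollows α' (projOut s)) :
    s <+: t ++ [valof c] := by
  rcases prefix_or_prefix_of_mem ht hs (follows_projIn_valof htx) hsx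
    (counterFollows_projOut_valof htα) hsα with h | h
  · by_cases hne : t ++ [valof c] = s
    · exact hne ▸ List.prefix_rfl
    have hsP := (φ.subset_responses hs).1
    obtain ⟨v, hv⟩ := extend_by_is hsP h hne
    have hpre := projIn_prefix hv
    rw [projIn_is, projIn_valof] at hpre
    exact absurd (hsx _ (append_value_mem_responses (projIn_mem_of_append hsP hpre)) hpre) (hfin v)
  · exact h

/-- An element of an affine algorithm ending with an output is determined by its output projection
and a strategy that its input projection follows. -/
theorem eq_of_projOut_eq {φ : Strategy (lolli S S')} {x : Strategy S} {s t : ArrowWord S S'}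
    {v' w' : S'.V} (hs : s ++ [output v'] ∈ φ.carrier) (ht : t ++ [output w'] ∈ φ.carrier)
    (hsx : Follows x (projIn s)) (htx : Follows x (projIn t)) (h : projOut s = projOut t) :
    s ++ [output v'] = t ++ [output w'] := by
  have hP := (φ.subset_responses hs).1
  have hsP := (mem_queries_of_append_value hP)
  have hfin : ∀ (u : S'.V) c', projOut s ++ [Sum.inr u] ++ [Sum.inl c'] ∉
      (counterBelow (projOut s) (projOut_mem hsP.1)).carrier := by
    intro u c' hc
    have := hc.2.length_le
    simp at this
  have hα := counterFollows_counterBelow (projOut s) (projOut_mem hsP.1)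
  have hα' : CounterFollows (counterBelow (projOut s) (projOut_mem hsP.1)) (projOut t) := by
    rwa [← h]
  refine prefix_antisymm ?_ ?_
  · exact prefix_of_final_output ht htx hα' (by rw [← h]; exact hfin w') hs
      (follows_projIn_output hsx) (counterFollows_projOut_output hα)
  · exact prefix_of_final_output hs hsx hα (hfin v') ht
      (follows_projIn_output htx) (counterFollows_projOut_output hα')

/-- An element of an affine algorithm ending with a `valof` is determined by its input projection
and a counter-strategy that its output projection follows. -/
theorem eq_of_projIn_eq {φ : Strategy (lolli S S')} {α' : CounterStrategy S'}
    {s t : ArrowWord S S'} {c d : S.C} (hs : s ++ [valof c] ∈ φ.carrier)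
    (ht : t ++ [valof d] ∈ φ.carrier) (hsα : CounterFollows α' (projOut s))
    (htα : CounterFollows α' (projOut t)) (h : projIn s = projIn t) :
    s ++ [valof c] = t ++ [valof d] := by
  have hfin : ∀ (u : S.C) v, projIn s ++ [Sum.inl u] ++ [Sum.inr v] ∉
      (below (projIn s)).carrier := by
    intro u v hv
    have := hv.2.length_le
    simp at this
  have hx := follows_below (projIn s)
  have hx' : Follows (below (projIn s)) (projIn t) := by rwa [← h]
  refine prefix_antisymm ?_ ?_
  · exact prefix_of_final_valof ht hx' htα (by rw [← h]; exact hfin d) hs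
      (follows_projIn_valof hx) (counterFollows_projOut_valof hsα)
  · exact prefix_of_final_valof hs hx hsα (hfin c) ht
      (follows_projIn_valof hx') (counterFollows_projOut_valof htα)

/-- The strategy `f_φ(x)`. -/
def applyStrategy (φ : Strategy (lolli S S')) (x : Strategy S) : Strategy S' :=
  Strategy.ofUnique (applyFun φ x)
    (by
      intro r' hr'
      obtain ⟨t, v', hs, rfl, -⟩ := mem_applyFun_iff.1 hr'
      exact projOut_mem_responses (φ.subset_responses hs).1)
    (by
      intro r' hr' t' ht' hpre
      obtain ⟨s, v', hs, rfl, hx⟩ := mem_applyFun_iff.1 hr'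
      obtain ⟨hP, w, u, rfl⟩ := ht'
      rw [← projOut_output] at hpre
      obtain ⟨t, ht, rfl⟩ := exists_prefix_output hpre
      have htP := append_singleton_mem (φ.subset_responses hs).1 ht
      refine mem_applyFun_iff.2
        ⟨t, u, φ.prefix_mem _ hs _ (append_value_mem_responses htP) ht, rfl, ?_⟩
      have := projIn_prefix ht
      rw [projIn_output, projIn_output] at this
      exact hx.of_prefix this)
    (by
      intro q v₁ v₂ h₁ h₂
      obtain ⟨s, v₁', hs, hs', hsx⟩ := mem_applyFun_iff.1 h₁
      obtain ⟨t, v₂', ht, ht', htx⟩ := mem_applyFun_iff.1 h₂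
      obtain ⟨hs₁, hs₂⟩ := List.append_inj' hs' rfl
      obtain ⟨ht₁, ht₂⟩ := List.append_inj' ht' rfl
      have := eq_of_projOut_eq hs ht hsx htx (hs₁.symm.trans ht₁)
      have := (List.append_inj' this rfl).2
      simp_all)

/-- The partial function `g_φ`: the set `applyCounter φ α'` is a counter-strategy as soon as it is
non-empty. -/
noncomputable def applyPartial (φ : Strategy (lolli S S')) (α' : CounterStrategy S') :
    WithBot (CounterStrategy S) :=
  open Classical in
  if h : (applyCounter φ α').Nonempty then
    (CounterStrategy.ofUnique (applyCounter φ α') h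
      (by
        intro q hq
        obtain ⟨t, c, hs, rfl, -⟩ := mem_applyCounter_iff.1 hq
        exact projIn_mem_queries (φ.subset_responses hs).1)
      (by
        intro q hq t' ht' hpre
        obtain ⟨s, c, hs, rfl, hα⟩ := mem_applyCounter_iff.1 hq
        obtain ⟨hP, w, d, rfl⟩ := ht'
        rw [← projIn_valof] at hpre
        obtain ⟨t, ht, rfl⟩ := exists_prefix_valof hpre
        have htP := append_singleton_mem (φ.subset_responses hs).1 ht
        refine mem_applyCounter_iff.2
          ⟨t, d, φ.prefix_mem _ hs _ (append_value_mem_responses htP) ht, rfl, ?_⟩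
        have := projOut_prefix ht
        rw [projOut_valof, projOut_valof] at this
        exact hα.of_prefix this)
      (by
        intro r c₁ c₂ h₁ h₂
        obtain ⟨s, c₁', hs, hs', hsα⟩ := mem_applyCounter_iff.1 h₁
        obtain ⟨t, c₂', ht, ht', htα⟩ := mem_applyCounter_iff.1 h₂
        obtain ⟨hs₁, hs₂⟩ := List.append_inj' hs' rfl
        obtain ⟨ht₁, ht₂⟩ := List.append_inj' ht' rfl
        have := eq_of_projIn_eq hs ht hsα htα (hs₁.symm.trans ht₁)
        have := (List.append_inj' this rfl).2
        simp_all) : CounterStrategy S)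
  else ⊥

theorem partialCarrier_applyPartial (φ : Strategy (lolli S S')) (α' : CounterStrategy S') :
    partialCarrier (applyPartial φ α') = applyCounter φ α' := by
  unfold applyPartial
  split_ifs with h
  · ext q
    exact mem_partialCarrier_coe
  · ext q
    exact ⟨fun hq => absurd hq not_mem_partialCarrier_bot, fun hq => absurd ⟨q, hq⟩ h⟩

theorem mem_of_applyPartial_eq {φ : Strategy (lolli S S')} {α' : CounterStrategy S'}
    {α : CounterStrategy S} (h : applyPartial φ α' = α) {q : S.Word} :
    q ∈ α.carrier ↔ q ∈ applyCounter φ α' := by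
  rw [← partialCarrier_applyPartial, h, mem_partialCarrier_coe]

theorem not_mem_of_applyPartial_eq_bot {φ : Strategy (lolli S S')} {α' : CounterStrategy S'}
    (h : applyPartial φ α' = ⊥) {q : S.Word} : q ∉ applyCounter φ α' := by
  rw [← partialCarrier_applyPartial, h]
  exact not_mem_partialCarrier_bot

/-- Directed suprema of strategies are unions. -/
theorem Strategy.mem_of_isLUB {d : Set (Strategy S)} (hdir : DirectedOn (· ≤ ·) d)
    {a : Strategy S} (ha : IsLUB d a) {r : S.Word} (hr : r ∈ a.carrier) :
    ∃ x ∈ d, r ∈ x.carrier := by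
  let U : Strategy S := Strategy.ofUnique {r | ∃ x ∈ d, r ∈ x.carrier}
    (by rintro r ⟨x, -, hx⟩; exact x.subset_responses hx)
    (by rintro r ⟨x, hxd, hx⟩ t ht htr; exact ⟨x, hxd, x.prefix_mem _ hx _ ht htr⟩)
    (by
      rintro q v₁ v₂ ⟨x, hxd, hx⟩ ⟨y, hyd, hy⟩
      obtain ⟨z, -, hxz, hyz⟩ := hdir x hxd y hyd
      exact z.value_unique (hxz hx) (hyz hy))
  have hU : a ≤ U := ha.2 fun x hx r hr => ⟨x, hx, hr⟩
  exact hU hr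

/-- Directed suprema of counter-strategies are unions. -/
theorem CounterStrategy.mem_of_isLUB {d : Set (CounterStrategy S)} (hne : d.Nonempty)
    (hdir : DirectedOn (· ≤ ·) d) {a : CounterStrategy S} (ha : IsLUB d a) {q : S.Word}
    (hq : q ∈ a.carrier) : ∃ α ∈ d, q ∈ α.carrier := by
  let U : CounterStrategy S := CounterStrategy.ofUnique {r | ∃ x ∈ d, r ∈ x.carrier}
    (let ⟨α, hα⟩ := hne
     let ⟨q, hq⟩ := α.nonempty
     ⟨q, α, hα, hq⟩)
    (by rintro r ⟨x, -, hx⟩; exact x.subset_queries hx)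
    (by rintro r ⟨x, hxd, hx⟩ t ht htr; exact ⟨x, hxd, x.prefix_mem _ hx _ ht htr⟩)
    (by
      rintro q v₁ v₂ ⟨x, hxd, hx⟩ ⟨y, hyd, hy⟩
      obtain ⟨z, -, hxz, hyz⟩ := hdir x hxd y hyd
      exact z.cell_unique (hxz hx) (hyz hy))
  have hU : a ≤ U := ha.2 fun x hx r hr => ⟨x, hx, hr⟩
  exact hU hq

theorem applyStrategy_continuous (φ : Strategy (lolli S S')) :
    ScottContinuous (applyStrategy φ) := by
  intro d hne hdir a ha
  have hmono : ∀ x ∈ d, applyStrategy φ x ≤ applyStrategy φ a := by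
    rintro x hx r' ⟨s, hs, hr', h⟩
    exact ⟨s, hs, hr', h.imp id fun h => ha.1 hx h⟩
  refine ⟨?_, fun b hb => ?_⟩
  · rintro _ ⟨x, hx, rfl⟩
    exact hmono x hx
  · rintro r' ⟨s, hs, hr', h⟩
    rcases h with h | h
    · obtain ⟨x, hx⟩ := hne
      exact hb ⟨x, hx, rfl⟩ ⟨s, hs, hr', Or.inl h⟩
    · obtain ⟨x, hx, hsx⟩ := Strategy.mem_of_isLUB hdir ha h
      exact hb ⟨x, hx, rfl⟩ ⟨s, hs, hr', Or.inr hsx⟩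

theorem applyPartial_continuous (φ : Strategy (lolli S S')) :
    ScottContinuous (applyPartial φ) := by
  intro d hne hdir a ha
  refine ⟨?_, fun b hb => ?_⟩
  · rintro _ ⟨α, hα, rfl⟩
    rw [← partialCarrier_subset_iff, partialCarrier_applyPartial, partialCarrier_applyPartial]
    rintro q ⟨s, hs, hq, h⟩
    exact ⟨s, hs, hq, ha.1 hα h⟩
  · rw [← partialCarrier_subset_iff, partialCarrier_applyPartial]
    rintro q ⟨s, hs, hq, h⟩
    obtain ⟨α, hα, hsα⟩ := CounterStrategy.mem_of_isLUB hne hdir ha h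
    have := partialCarrier_subset_iff.2 (hb ⟨α, hα, rfl⟩)
    rw [partialCarrier_applyPartial] at this
    exact this ⟨s, hs, hq, hsα⟩

theorem mem_applyCounter_of_prefix {φ : Strategy (lolli S S')} {α' : CounterStrategy S'}
    {s : ArrowWord S S'} (hs : s ∈ φ.carrier) (hα : CounterFollows α' (projOut s)) {q : S.Word}
    (hq : q ∈ S.queries) (hpre : q <+: projIn s) : q ∈ applyCounter φ α' := by
  obtain ⟨-, w, c, rfl⟩ := hq
  obtain ⟨t, ht, rfl⟩ := exists_prefix_valof hpre
  have htP := append_singleton_mem (φ.subset_responses hs).1 ht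
  refine mem_applyCounter_iff.2
    ⟨t, c, φ.prefix_mem _ hs _ (append_value_mem_responses htP) ht, rfl, hα.of_prefix ?_⟩
  have := projOut_prefix ht
  rwa [projOut_valof] at this

theorem mem_applyFun_of_prefix {φ : Strategy (lolli S S')} {x : Strategy S}
    {s : ArrowWord S S'} (hs : s ∈ φ.carrier) (hx : Follows x (projIn s)) {r' : S'.Word}
    (hr' : r' ∈ S'.responses) (hpre : r' <+: projOut s) : r' ∈ applyFun φ x := by
  obtain ⟨-, w, v', rfl⟩ := hr'
  obtain ⟨t, ht, rfl⟩ := exists_prefix_output hpre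
  have htP := append_singleton_mem (φ.subset_responses hs).1 ht
  refine mem_applyFun_iff.2
    ⟨t, v', φ.prefix_mem _ hs _ (append_value_mem_responses htP) ht, rfl, hx.of_prefix ?_⟩
  have := projIn_prefix ht
  rwa [projIn_output] at this

theorem applyStrategy_axiomL (φ : Strategy (lolli S S')) (x : Strategy S) (α' : CounterStrategy S')
    (hwin : Wins (applyStrategy φ x) α') :
    ∃ y : Strategy S, IsLeast {z : Strategy S | z ≤ x ∧ Wins (applyStrategy φ z) α'} y ∧
      ((applyPartial φ α' = ⊥ ∧ y.carrier = ∅) ∨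
        ∃ (α : CounterStrategy S) (r : S.Word),
          applyPartial φ α' = (α : WithBot (CounterStrategy S)) ∧
          r ∈ S.responses ∧ IsPlay x α r ∧ y.carrier = {t | t ∈ S.responses ∧ t <+: r}) := by
  obtain ⟨r', hr', hplay⟩ := hwin
  obtain ⟨hf, hα, hfin⟩ := (isPlay_response_iff hr').1 hplay
  obtain ⟨t, v', hs, rfl, hx⟩ := mem_applyFun_iff.1 hf
  have hsP := (φ.subset_responses hs).1
  have hα₀ : CounterFollows α' (projOut t) := hα.of_prefix (List.prefix_append _ _)
  have hmax : ∀ s ∈ φ.carrier, Follows x (projIn s) → CounterFollows α' (projOut s) →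
      s <+: t ++ [output v'] :=
    fun s h₁ h₂ h₃ => prefix_of_final_output hs hx hα₀ hfin h₁ h₂ h₃
  refine ⟨below (projIn t), ⟨⟨hx.below_le, ?_⟩, ?_⟩, ?_⟩
  · refine ⟨_, hr', (isPlay_response_iff hr').2 ⟨?_, hα, hfin⟩⟩
    exact mem_applyFun_iff.2 ⟨t, v', hs, rfl, follows_below _⟩
  · rintro z ⟨hzx, r₂, hr₂, hplay₂⟩
    obtain ⟨hf₂, hα₂, hfin₂⟩ := (isPlay_response_iff hr₂).1 hplay₂
    obtain ⟨t₂, v₂', hs₂, rfl, hx₂⟩ := mem_applyFun_iff.1 hf₂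
    have hα₃ := hα₂.of_prefix (List.prefix_append _ _)
    have h₁ := hmax _ hs₂ (follows_projIn_output (hx₂.mono hzx))
      (counterFollows_projOut_output hα₃)
    have h₂ := prefix_of_final_output hs₂ (hx₂.mono hzx) hα₃ hfin₂ hs
      (follows_projIn_output hx) (counterFollows_projOut_output hα₀)
    obtain ⟨rfl, -⟩ := List.append_inj' (prefix_antisymm h₁ h₂) rfl
    exact hx₂.below_le
  · have hin := not_endsCell_projIn_of_append_output hsP
    have hcarrier : ∀ q ∈ S.queries, q <+: projIn t → q ∈ applyCounter φ α' := by
      intro q hq hpre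
      exact mem_applyCounter_of_prefix hs (counterFollows_projOut_output hα₀) hq
        (by rwa [projIn_output])
    have htP : t ∈ (lolli S S').P := (mem_queries_of_append_value hsP).1
    cases hg : applyPartial φ α' with
    | bot =>
      refine Or.inl ⟨rfl, ?_⟩
      rcases projIn_nil_or_mem_responses htP hin with h0 | h0
      · rw [h0]
        ext r
        refine ⟨fun hr => absurd hr.2 fun h => ?_, fun hr => absurd hr (Set.notMem_empty r)⟩
        exact S.ne_nil _ hr.1.1 (List.prefix_nil.1 h)
      · obtain ⟨c, hc, hq⟩ := first_cell_mem h0.1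
        exact absurd (hcarrier _ hq hc) (not_mem_of_applyPartial_eq_bot hg)
    | coe α =>
      refine Or.inr ⟨α, projIn t, rfl, ?_⟩
      have hr : projIn t ∈ S.responses := by
        refine (projIn_nil_or_mem_responses htP hin).resolve_left fun h0 => ?_
        -- The first query of `α` comes from an element of `φ` that precedes `t`.
        obtain ⟨q, hq⟩ := α.nonempty
        obtain ⟨c, hc, hqc⟩ := first_cell_mem (α.subset_queries hq).1
        have hcα := (mem_of_applyPartial_eq hg).1 (α.prefix_mem _ hq _ hqc hc)
        obtain ⟨s, d, hs₁, hd, hα₁⟩ := mem_applyCounter_iff.1 hcα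
        have hd0 : projIn s = [] := by
          have := congrArg List.length hd
          exact List.length_eq_zero_iff.1 (by simpa using this.symm)
        have := projIn_prefix (hmax _ hs₁ (follows_projIn_valof (by rw [hd0]; exact Follows.nil x))
          (counterFollows_projOut_valof hα₁))
        rw [projIn_output, h0, projIn_valof] at this
        have := this.length_le
        simp at this
      refine ⟨hr, (isPlay_response_iff hr).2 ⟨hx _ hr List.prefix_rfl, ?_, ?_⟩, rfl⟩
      · exact fun q hq hpre => (mem_of_applyPartial_eq hg).2 (hcarrier q hq hpre)
      · intro c hc
        obtain ⟨s, d, hs₁, hd, hα₁⟩ := mem_applyCounter_iff.1 ((mem_of_applyPartial_eq hg).1 hc)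
        obtain ⟨hd₁, -⟩ := List.append_inj' hd rfl
        have := projIn_prefix (hmax _ hs₁ (follows_projIn_valof (by rwa [← hd₁]))
          (counterFollows_projOut_valof hα₁))
        rw [projIn_output, projIn_valof, ← hd₁] at this
        exact not_append_prefix_self this

theorem applyPartial_axiomR (φ : Strategy (lolli S S')) (α' : CounterStrategy S') (x : Strategy S)
    (α : CounterStrategy S) (hg : applyPartial φ α' = (α : WithBot (CounterStrategy S)))
    (hlose : Loses x α) :
    ∃ β : CounterStrategy S',
      IsLeast {γ : CounterStrategy S' | γ ≤ α' ∧
        ∃ δ : CounterStrategy S, applyPartial φ γ = (δ : WithBot (CounterStrategy S)) ∧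
          Loses x δ} β ∧
      ∃ q' ∈ S'.queries, IsPlay (applyStrategy φ x) α' q' ∧
        β.carrier = {t | t ∈ S'.queries ∧ t <+: q'} := by
  obtain ⟨q, hq, hplay⟩ := hlose
  obtain ⟨hqα, hx, hfin⟩ := (isPlay_query_iff hq).1 hplay
  obtain ⟨t, c, hs, rfl, hα⟩ := mem_applyCounter_iff.1 ((mem_of_applyPartial_eq hg).1 hqα)
  have hsP := (φ.subset_responses hs).1
  have htP := mem_queries_of_append_value hsP
  have hx₀ : Follows x (projIn t) := hx.of_prefix (List.prefix_append _ _)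
  have hmax : ∀ s ∈ φ.carrier, Follows x (projIn s) → CounterFollows α' (projOut s) →
      s <+: t ++ [valof c] :=
    fun s h₁ h₂ h₃ => prefix_of_final_valof hs hx₀ hα hfin h₁ h₂ h₃
  have hq' : projOut t ∈ S'.queries := projOut_mem_queries htP.1 htP.2
  refine ⟨counterBelow (projOut t) hq'.1, ⟨⟨hα.counterBelow_le hq'.1, ?_⟩, ?_⟩,
    projOut t, hq', ?_, rfl⟩
  · have hmem : projIn t ++ [Sum.inl c] ∈ applyCounter φ (counterBelow (projOut t) hq'.1) :=
      mem_applyCounter_iff.2 ⟨t, c, hs, rfl, counterFollows_counterBelow _ _⟩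
    cases hδ : applyPartial φ (counterBelow (projOut t) hq'.1) with
    | bot => exact absurd hmem (not_mem_of_applyPartial_eq_bot hδ)
    | coe δ =>
      exact ⟨δ, rfl, _, hq,
        (isPlay_query_iff hq).2 ⟨(mem_of_applyPartial_eq hδ).2 hmem, hx, hfin⟩⟩
  · rintro γ ⟨hγα, δ, hδ, q₂, hq₂, hplay₂⟩
    obtain ⟨hqδ, hx₂, hfin₂⟩ := (isPlay_query_iff hq₂).1 hplay₂
    obtain ⟨t₂, c₂, hs₂, rfl, hα₂⟩ := mem_applyCounter_iff.1 ((mem_of_applyPartial_eq hδ).1 hqδ)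
    have hx₃ := hx₂.of_prefix (List.prefix_append _ _)
    have hα₃ : CounterFollows α' (projOut t₂) := fun q hq hpre => hγα (hα₂ q hq hpre)
    have h₁ := hmax _ hs₂ (follows_projIn_valof hx₃) (counterFollows_projOut_valof hα₃)
    have h₂ := prefix_of_final_valof hs₂ hx₃ hα₃ hfin₂ hs
      (follows_projIn_valof hx₀) (counterFollows_projOut_valof hα)
    obtain ⟨rfl, -⟩ := List.append_inj' (prefix_antisymm h₁ h₂) rfl
    exact hα₂.counterBelow_le _
  · refine (isPlay_query_iff hq').2 ⟨hα _ hq' List.prefix_rfl, fun r' hr' hpre => ?_, ?_⟩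
    · exact mem_applyFun_of_prefix hs (follows_projIn_valof hx₀) hr' (by rwa [projOut_valof])
    · intro v' hv'
      obtain ⟨s, d, hs₁, hd, hx₁⟩ := mem_applyFun_iff.1 hv'
      obtain ⟨hd₁, -⟩ := List.append_inj' hd rfl
      have := projOut_prefix (hmax _ hs₁ (follows_projIn_output hx₁)
        (counterFollows_projOut_output (by rwa [← hd₁])))
      rw [projOut_output, projOut_valof, ← hd₁] at this
      exact not_append_prefix_self this

/-- The symmetric algorithm `(f_φ, g_φ)`. -/
noncomputable def toSymmetric (φ : Strategy (lolli S S')) : SymmetricAlgorithm S S' where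
  f := applyStrategy φ
  g := applyPartial φ
  f_continuous := applyStrategy_continuous φ
  g_continuous := applyPartial_continuous φ
  axiomL x α' _ h := applyStrategy_axiomL φ x α' h
  axiomR α' x α _ hg h := applyPartial_axiomR φ α' x α hg h

end ToSymmetric

/-! ### The affine algorithm of a symmetric algorithm -/

section Trace

variable {S S' : SDS.{u}}

/-- The response `s` of the arrow is a move justified by `(f, g)`: an output is a value of `f` on
the input explored so far, and a `valof` is a query of `g` on the output explored so far. -/
def Realizes (f : Strategy S → Strategy S') (g : CounterStrategy S' → WithBot (CounterStrategy S))
    (s : ArrowWord S S') : Prop :=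
  projOut s ∈ (f (below (projIn s))).carrier ∨
    ∃ h : projOut s ∈ S'.P, projIn s ∈ partialCarrier (g (counterBelow (projOut s) h))

/-- `f` and `g` never both win: no finite `x` and `α'` are such that `f x` wins against `α'` while
`g α'` wins against `x`. Only strategies and counter-strategies of prefixes of a position are
considered. -/
def Orthogonal (f : Strategy S → Strategy S')
    (g : CounterStrategy S' → WithBot (CounterStrategy S)) : Prop :=
  ∀ (p : S.Word) (p' : S'.Word) (hp' : p' ∈ S'.P) (α : CounterStrategy S),
    g (counterBelow p' hp') = α → Wins (f (below p)) (counterBelow p' hp') →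
      Loses (below p) α → False

variable {f : Strategy S → Strategy S'} {g : CounterStrategy S' → WithBot (CounterStrategy S)}

theorem realizes_output_iff {s : ArrowWord S S'} {v' : S'.V}
    (hs : s ++ [output v'] ∈ (lolli S S').P) :
    Realizes f g (s ++ [output v']) ↔
      projOut s ++ [Sum.inr v'] ∈ (f (below (projIn s))).carrier := by
  unfold Realizes
  simp only [projOut_output, projIn_output]
  refine or_iff_left ?_
  rintro ⟨h, α, -, hα⟩
  exact not_endsCell_projIn_of_append_output hs (α.subset_queries hα).2

theorem realizes_valof_iff {s : ArrowWord S S'} {c : S.C} (hs : s ++ [valof c] ∈ (lolli S S').P)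
    (h : projOut s ∈ S'.P) :
    Realizes f g (s ++ [valof c]) ↔
      projIn s ++ [Sum.inl c] ∈ partialCarrier (g (counterBelow (projOut s) h)) := by
  unfold Realizes
  simp only [projOut_valof, projIn_valof]
  constructor
  · rintro (h₁ | ⟨_, h₁⟩)
    · exact absurd (endsCell_projOut_of_append_valof hs)
        (mem_responses_iff.1 (Strategy.subset_responses _ h₁)).2
    · exact h₁
  · exact fun h₁ => Or.inr ⟨h, h₁⟩

theorem Orthogonal.not_both (hfg : Orthogonal f g) {p : S.Word} {c : S.C} {p' : S'.Word} {v' : S'.V}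
    (hp' : p' ∈ S'.P) (h₁ : p' ++ [Sum.inr v'] ∈ (f (below p)).carrier)
    (h₂ : p ++ [Sum.inl c] ∈ partialCarrier (g (counterBelow p' hp'))) : False := by
  obtain ⟨α, hα, hc⟩ := h₂
  exact hfg p p' hp' α hα ⟨_, Strategy.subset_responses _ h₁, isPlay_counterBelow hp' h₁⟩
    ⟨_, α.subset_queries hc, isPlay_below hc⟩

/-- The affine algorithm of the responses of the arrow all of whose moves are justified by
`(f, g)`. -/
def trace (f : Strategy S → Strategy S') (g : CounterStrategy S' → WithBot (CounterStrategy S))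
    (hfg : Orthogonal f g) : Strategy (lolli S S') :=
  Strategy.ofUnique
    {s | s ∈ (lolli S S').responses ∧ ∀ t ∈ (lolli S S').responses, t <+: s → Realizes f g t}
    (fun _ h => h.1) (fun _ hr _ ht htr => ⟨ht, fun _ hu hut => hr.2 _ hu (hut.trans htr)⟩) (by
      rintro q m n ⟨hm, h₁⟩ ⟨hn, h₂⟩
      have h₁ := h₁ _ hm List.prefix_rfl
      have h₂ := h₂ _ hn List.prefix_rfl
      have hq := mem_queries_of_append_value hm.1
      have hP := projOut_mem hq.1
      rcases m with v₁ | c₁ <;> rcases n with v₂ | c₂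
      · have h₁ := (realizes_output_iff hm.1).1 h₁
        have h₂ := (realizes_output_iff hn.1).1 h₂
        rw [Strategy.value_unique _ h₁ h₂]
      · exact (hfg.not_both hP ((realizes_output_iff hm.1).1 h₁)
          ((realizes_valof_iff hn.1 hP).1 h₂)).elim
      · exact (hfg.not_both hP ((realizes_output_iff hn.1).1 h₂)
          ((realizes_valof_iff hm.1 hP).1 h₁)).elim
      · obtain ⟨α, hα, h₁⟩ := (realizes_valof_iff hm.1 hP).1 h₁
        obtain ⟨β, hβ, h₂⟩ := (realizes_valof_iff hn.1 hP).1 h₂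
        obtain rfl : α = β := WithBot.coe_injective (hα.symm.trans hβ)
        rw [CounterStrategy.cell_unique _ h₁ h₂])

variable {hfg : Orthogonal f g}

theorem realizes_of_mem_trace {s : ArrowWord S S'} (hs : s ∈ (trace f g hfg).carrier) :
    Realizes f g s := hs.2 _ hs.1 List.prefix_rfl

theorem mem_trace_of_follows {s : ArrowWord S S'} (hs : Follows (trace f g hfg) s)
    {m : (lolli S S').V} (hP : s ++ [Sum.inr m] ∈ (lolli S S').P)
    (hm : Realizes f g (s ++ [Sum.inr m])) : s ++ [Sum.inr m] ∈ (trace f g hfg).carrier := by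
  refine ⟨append_value_mem_responses hP, fun t ht htr => ?_⟩
  rcases List.prefix_concat_iff.1 htr with rfl | h
  · exact hm
  · exact realizes_of_mem_trace (hs t ht h)

theorem follows_projOut_of_follows_trace (hf : Monotone f) {s : ArrowWord S S'}
    (hs : Follows (trace f g hfg) s) (hP : s ∈ (lolli S S').P) :
    Follows (f (below (projIn s))) (projOut s) := by
  rintro r' ⟨-, w, v', rfl⟩ hpre
  obtain ⟨t, ht, rfl⟩ := exists_prefix_output hpre
  have htP := append_singleton_mem hP ht
  have := (realizes_output_iff htP).1
    (realizes_of_mem_trace (hs _ (append_value_mem_responses htP) ht))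
  exact hf (below_mono ((projIn_prefix (List.prefix_append _ _)).trans (projIn_prefix ht))) this

theorem mem_g_of_follows_trace (hg : Monotone g) {s : ArrowWord S S'}
    (hs : Follows (trace f g hfg) s) (hP : s ∈ (lolli S S').P) {α' : CounterStrategy S'}
    (hα : CounterFollows α' (projOut s)) {q : S.Word} (hq : q ∈ S.queries) (hpre : q <+: projIn s) :
    q ∈ partialCarrier (g α') := by
  obtain ⟨-, w, c, rfl⟩ := hq
  obtain ⟨t, ht, rfl⟩ := exists_prefix_valof hpre
  have htP := append_singleton_mem hP ht
  have htP' := projOut_mem (mem_queries_of_append_value htP).1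
  have := (realizes_valof_iff htP htP').1
    (realizes_of_mem_trace (hs _ (append_value_mem_responses htP) ht))
  refine partialCarrier_subset_iff.2 (hg (CounterFollows.counterBelow_le (hα.of_prefix ?_) _)) this
  exact (projOut_prefix (List.prefix_append _ _)).trans (projOut_prefix ht)

theorem applyFun_trace_subset (hf : Monotone f) (x : Strategy S) :
    applyFun (trace f g hfg) x ⊆ (f x).carrier := by
  intro r' hr'
  obtain ⟨t, v', ht, rfl, hx⟩ := mem_applyFun_iff.1 hr'
  exact hf hx.below_le ((realizes_output_iff ht.1.1).1 (realizes_of_mem_trace ht))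

theorem applyCounter_trace_subset (hg : Monotone g) (α' : CounterStrategy S') :
    applyCounter (trace f g hfg) α' ⊆ partialCarrier (g α') := by
  intro q hq
  obtain ⟨t, c, ht, rfl, hα⟩ := mem_applyCounter_iff.1 hq
  have hP := projOut_mem (mem_queries_of_append_value ht.1.1).1
  exact partialCarrier_subset_iff.2 (hg (hα.counterBelow_le hP))
    ((realizes_valof_iff ht.1.1 hP).1 (realizes_of_mem_trace ht))

end Trace

section Symmetric

variable {S S' : SDS.{u}} (A : SymmetricAlgorithm S S')

theorem SymmetricAlgorithm.f_mono : Monotone A.f := A.f_continuous.monotone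

theorem SymmetricAlgorithm.g_mono : Monotone A.g := A.g_continuous.monotone

/-- If `A.f x` answers the query `q'` of `S'` while `A.f y` does not, then `A.g`
asks for more of `x` than `y` provides. -/
theorem SymmetricAlgorithm.exists_play_of_not_mem {x y : Strategy S} {q' : S'.Word}
    {v' : S'.V} (hq' : q' ∈ S'.P) (h : q' ++ [Sum.inr v'] ∈ (A.f x).carrier)
    (hy : q' ++ [Sum.inr v'] ∉ (A.f y).carrier) :
    ∃ (α : CounterStrategy S) (r : S.Word), A.g (counterBelow q' hq') = α ∧ r ∈ S.responses ∧
      IsPlay x α r ∧ ¬ below r ≤ y := by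
  obtain ⟨m, ⟨⟨hmx, hwin⟩, _⟩, hm⟩ := A.axiomL x (counterBelow q' hq')
    (counterBelow_finite _ _) ⟨_, Strategy.subset_responses _ h, isPlay_counterBelow hq' h⟩
  rw [wins_counterBelow_iff hq' (A.f_mono hmx) h] at hwin
  rcases hm with ⟨-, hm⟩ | ⟨α, r, hα, hr, hplay, hm⟩
  · refine absurd (A.f_mono (fun t ht => ?_) hwin) hy
    rw [hm] at ht
    exact absurd ht (Set.notMem_empty t)
  · refine ⟨α, r, hα, hr, hplay, fun hle => hy (A.f_mono (fun t ht => hle ?_) hwin)⟩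
    rw [hm] at ht
    exact ht

/-- If `A.g α'` extends the word `p` of `S` while `A.g β'` does not, then `A.f`
asks for more of `α'` than `β'` provides. -/
theorem SymmetricAlgorithm.exists_play_of_not_mem_g {α' β' : CounterStrategy S'}
    {p : S.Word} {c : S.C} (h : p ++ [Sum.inl c] ∈ partialCarrier (A.g α'))
    (hβ : p ++ [Sum.inl c] ∉ partialCarrier (A.g β')) :
    ∃ (q' : S'.Word) (hq' : q' ∈ S'.queries), IsPlay (A.f (below p)) α' q' ∧
      ¬ counterBelow q' hq'.1 ≤ β' := by
  obtain ⟨α, hα, hc⟩ := h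
  obtain ⟨m, ⟨⟨hmα, δ, hδ, hlose⟩, _⟩, q', hq', hplay, hm⟩ := A.axiomR α' (below p) α
    (below_finite _) hα ⟨_, α.subset_queries hc, isPlay_below hc⟩
  have hδα : δ ≤ α := by
    have := A.g_mono hmα
    rwa [hα, hδ, WithBot.coe_le_coe] at this
  rw [loses_below_iff hδα hc] at hlose
  refine ⟨q', hq', hplay, fun hle => hβ ?_⟩
  have hmβ : m ≤ β' := fun t ht => hle (by
    rw [hm] at ht
    exact ht)
  exact partialCarrier_subset_iff.2 (A.g_mono hmβ) ⟨δ, hδ, hlose⟩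

theorem SymmetricAlgorithm.orthogonal : Orthogonal A.f A.g := by
  intro p p' hp' α hα hwin hlose
  obtain ⟨y, -, hy | ⟨β, r, hβ, hr, hplay, -⟩⟩ :=
    A.axiomL (below p) (counterBelow p' hp') (counterBelow_finite _ _) hwin
  · rw [hα] at hy
    exact WithBot.coe_ne_bot hy.1
  · obtain rfl : α = β := WithBot.coe_injective (hα.symm.trans hβ)
    exact not_wins_and_loses ⟨r, hr, hplay⟩ hlose

/-- The affine algorithm of a symmetric algorithm. -/
def SymmetricAlgorithm.toAffine : Strategy (lolli S S') := trace A.f A.g A.orthogonal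

theorem request_mem {c' : S'.C} (h : [Sum.inl c'] ∈ S'.P) :
    [(request c' : ArrowMove S S')] ∈ (lolli S S').P :=
  append_request_mem (s := []) (Or.inl rfl) (by simp) (by simp) h

theorem follows_request {φ : Strategy (lolli S S')} (c' : S'.C) : Follows φ [request c'] :=
  Follows.append_cell (Follows.nil φ) _

/-- Every value of `A.f` is reached by its affine algorithm: as long as the value has not been
output, either `A.f` already produces the next value on the input explored so far, or axiom (L)
provides a query of `A.g`, whose answer belongs to `x`. -/
theorem SymmetricAlgorithm.subset_applyFun (x : Strategy S) :
    (A.f x).carrier ⊆ applyFun A.toAffine x := by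
  intro r' hr'
  have hr'P := ((A.f x).subset_responses hr')
  -- The play that (L) provides for the last query of `r'` bounds the input explored.
  obtain ⟨K, hK⟩ : ∃ K, ∀ s ∈ (lolli S S').P, Follows A.toAffine s → projOut s <+: r' →
      Follows x (projIn s) → (projIn s).length ≤ K := by
    obtain ⟨-, w, v', rfl⟩ := id hr'P
    have hw := mem_queries_of_append_value hr'P.1
    have hα' := (counterFollows_counterBelow w hw.1).append_value v'
    obtain ⟨y, -, hy⟩ := A.axiomL x (counterBelow w hw.1) (counterBelow_finite _ _)
      ⟨_, hr'P, isPlay_counterBelow hw.1 hr'⟩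
    rcases hy with ⟨hy, -⟩ | ⟨α, r, hα, hr, hplay, -⟩
    · refine ⟨0, fun s hs hsA hsr hsx => ?_⟩
      rcases projIn_mem hs with h | h
      · simp [h]
      · obtain ⟨c, hc, hq⟩ := first_cell_mem h
        have := mem_g_of_follows_trace A.g_mono hsA hs (hα'.of_prefix hsr) hq hc
        rw [hy] at this
        exact absurd this not_mem_partialCarrier_bot
    · refine ⟨r.length, fun s hs hsA hsr hsx => ?_⟩
      rcases projIn_mem hs with h | h
      · simp [h]
      · refine (hplay.2 _ ⟨h, hsx, fun q hq hpre => ?_⟩).length_le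
        have := mem_g_of_follows_trace A.g_mono hsA hs (hα'.of_prefix hsr) hq hpre
        rwa [hα, mem_partialCarrier_coe] at this
  obtain ⟨c', hc', hc'q⟩ := first_cell_mem hr'P.1
  refine of_bounded_extension (good := fun s : ArrowWord S S' => s ∈ (lolli S S').P ∧ EndsCell s ∧
    Follows A.toAffine s ∧ projOut s <+: r' ∧ Follows x (projIn s)) List.length (K + r'.length)
    ?_ ?_ (a := [request c']) ⟨request_mem hc'q.1, by simp, follows_request c', hc', Follows.nil x⟩
  · rintro s ⟨hs, -, hsA, hsr, hsx⟩
    have h₁ := length_projIn_add_length_projOut s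
    have h₂ := hK s hs hsA hsr hsx
    have h₃ := hsr.length_le
    omega
  · rintro s ⟨hs, hsc, hsA, hsr, hsx⟩
    have hout := projOut_mem_queries hs hsc
    have hin := not_endsCell_projIn hs hsc
    obtain ⟨v', hv'⟩ := extend_by_value hr'P.1 hsr
      (fun h => (mem_responses_iff.1 hr'P).2 (h ▸ hout.2)) hout.2
    have hv'P := append_singleton_mem hr'P.1 hv'
    have hv'x := (A.f x).prefix_mem _ hr' _ (append_value_mem_responses hv'P) hv'
    by_cases hmem : projOut s ++ [Sum.inr v'] ∈ (A.f (below (projIn s))).carrier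
    · have hsP := append_output_mem hs hsc hv'P
      have hsA' := mem_trace_of_follows hsA hsP ((realizes_output_iff hsP).2 hmem)
      by_cases hend : projOut s ++ [Sum.inr v'] = r'
      · exact Or.inl (mem_applyFun_iff.2 ⟨s, v', hsA', hend.symm, hsx⟩)
      · right
        obtain ⟨d', hd'⟩ := extend_by_cell hr'P.1 hv' hend (by simp)
        refine ⟨s ++ [output v'] ++ [request d'], ⟨?_,
          (endsCell_append_singleton _ _).2 rfl, ?_, ?_,
          by rwa [projIn_request, projIn_output]⟩, by simp⟩
        · refine append_request_mem (Or.inr hsP) (by simp) (by simpa using hin) ?_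
          rw [projOut_output]
          exact append_singleton_mem hr'P.1 hd'
        · exact (Follows.of_mem hsA').append_cell _
        · rwa [projOut_request, projOut_output]
    · right
      obtain ⟨α, r, hα, hr, hplay, hle⟩ :=
        A.exists_play_of_not_mem hout.1 hv'x hmem
      have hpre : projIn s <+: r := by
        rcases projIn_mem hs with h | h
        · rw [h]; exact List.nil_prefix
        · refine hplay.2 _ ⟨h, hsx, fun q hq hpre => ?_⟩
          have := mem_g_of_follows_trace A.g_mono hsA hs
            (counterFollows_counterBelow _ hout.1) hq hpre
          rwa [hα, mem_partialCarrier_coe] at this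
      obtain ⟨c, hc⟩ := extend_by_cell hr.1 hpre (fun h => hle (h ▸ le_rfl)) hin
      obtain ⟨v, hv⟩ := extend_by_value hr.1 hc
        (fun h => (mem_responses_iff.1 hr).2 (by rw [← h]; simp)) (by simp)
      have hcP := append_singleton_mem hr.1 hc
      have hvP := append_singleton_mem hr.1 hv
      have hsP := append_valof_mem hs hsc hcP
      have hsA' := mem_trace_of_follows hsA hsP ((realizes_valof_iff hsP hout.1).2
        ⟨α, hα, hplay.1.2.2 _ (append_cell_mem_queries hcP) hc⟩)
      refine ⟨s ++ [valof c] ++ [is v], ⟨?_, (endsCell_append_singleton _ _).2 rfl, ?_,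
        by rwa [projOut_is, projOut_valof], ?_⟩, by simp⟩
      · refine append_is_mem hsP (by simp) ?_
        rwa [projIn_valof]
      · exact (Follows.of_mem hsA').append_cell _
      · rw [projIn_is, projIn_valof]
        exact Follows.of_prefix hplay.1.2.1 hv

/-- Every query of `A.g` is reached by its affine algorithm: as long as the query has not been
asked, either `A.g` already asks the next cell on the output explored so far, or axiom (R) provides
a value of `A.f`, which `α'` pursues. -/
theorem SymmetricAlgorithm.subset_applyCounter (α' : CounterStrategy S') :
    partialCarrier (A.g α') ⊆ applyCounter A.toAffine α' := by
  rintro q ⟨α, hα, hqα⟩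
  have hq := α.subset_queries hqα
  -- The play that (R) provides for the input below `q` bounds the output explored.
  obtain ⟨K, hK⟩ : ∃ K, ∀ s ∈ (lolli S S').P, Follows A.toAffine s → projIn s <+: q →
      CounterFollows α' (projOut s) → (projOut s).length ≤ K := by
    obtain ⟨-, w, c, rfl⟩ := id hq
    obtain ⟨-, -, q', hq', hplay, -⟩ := A.axiomR α' (below w) α (below_finite _) hα
      ⟨_, hq, isPlay_below hqα⟩
    refine ⟨q'.length, fun s hs hsA hsq hsα => ?_⟩
    refine (hplay.2 _ ⟨projOut_mem hs, fun r' hr' hpre => ?_, hsα⟩).length_le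
    refine A.f_mono ?_ (follows_projOut_of_follows_trace A.f_mono hsA hs r' hr' hpre)
    exact Follows.below_le (((follows_below w).append_cell c).of_prefix hsq)
  obtain ⟨q₀, hq₀⟩ := α'.nonempty
  obtain ⟨c', hc', hc'q⟩ := first_cell_mem (α'.subset_queries hq₀).1
  have hc'α := α'.prefix_mem _ hq₀ _ hc'q hc'
  refine of_bounded_extension (good := fun s : ArrowWord S S' => s ∈ (lolli S S').P ∧ EndsCell s ∧
    Follows A.toAffine s ∧ projIn s <+: q ∧ CounterFollows α' (projOut s)) List.length
    (K + q.length) ?_ ?_ (a := [request c'])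
    ⟨request_mem hc'q.1, by simp, follows_request c', List.nil_prefix, CounterFollows.of_mem hc'α⟩
  · rintro s ⟨hs, -, hsA, hsq, hsα⟩
    have h₁ := length_projIn_add_length_projOut s
    have h₂ := hK s hs hsA hsq hsα
    have h₃ := hsq.length_le
    omega
  · rintro s ⟨hs, hsc, hsA, hsq, hsα⟩
    have hout := projOut_mem_queries hs hsc
    have hin := not_endsCell_projIn hs hsc
    obtain ⟨c, hc⟩ := extend_by_cell hq.1 hsq (fun h => hin (h ▸ hq.2)) hin
    have hcP := append_singleton_mem hq.1 hc
    have hcα := α.prefix_mem _ hqα _ (append_cell_mem_queries hcP) hc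
    by_cases hmem : projIn s ++ [Sum.inl c] ∈
        partialCarrier (A.g (counterBelow (projOut s) hout.1))
    · have hsP := append_valof_mem hs hsc hcP
      have hsA' := mem_trace_of_follows hsA hsP ((realizes_valof_iff hsP hout.1).2 hmem)
      by_cases hend : projIn s ++ [Sum.inl c] = q
      · exact Or.inl (mem_applyCounter_iff.2 ⟨s, c, hsA', hend.symm, hsα⟩)
      · right
        obtain ⟨v, hv⟩ := extend_by_value hq.1 hc hend (by simp)
        refine ⟨s ++ [valof c] ++ [is v], ⟨?_,
          (endsCell_append_singleton _ _).2 rfl, ?_, ?_,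
          by rwa [projOut_is, projOut_valof]⟩, by simp⟩
        · refine append_is_mem hsP (by simp) ?_
          rw [projIn_valof]
          exact append_singleton_mem hq.1 hv
        · exact (Follows.of_mem hsA').append_cell _
        · rwa [projIn_is, projIn_valof]
    · right
      obtain ⟨q', hq', hplay, hle⟩ := A.exists_play_of_not_mem_g
        ⟨α, hα, hcα⟩ hmem
      have hpre : projOut s <+: q' :=
        hplay.2 _ ⟨hout.1, follows_projOut_of_follows_trace A.f_mono hsA hs, hsα⟩
      obtain ⟨v', hv'⟩ := extend_by_value hq'.1 hpre
        (by rintro h; exact hle (by simp only [h]; exact le_rfl)) hout.2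
      obtain ⟨d', hd'⟩ := extend_by_cell hq'.1 hv'
        (fun h => by have := hq'.2; rw [← h] at this; simp at this) (by simp)
      have hv'P := append_singleton_mem hq'.1 hv'
      have hd'P := append_singleton_mem hq'.1 hd'
      have hsP := append_output_mem hs hsc hv'P
      have hsA' := mem_trace_of_follows hsA hsP ((realizes_output_iff hsP).2
        (hplay.1.2.1 _ (append_value_mem_responses hv'P) hv'))
      refine ⟨s ++ [output v'] ++ [request d'], ⟨?_, (endsCell_append_singleton _ _).2 rfl, ?_,
        by rwa [projIn_request, projIn_output], ?_⟩, by simp⟩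
      · refine append_request_mem (Or.inr hsP) (by simp) (by simpa using hin) ?_
        rwa [projOut_output]
      · exact (Follows.of_mem hsA').append_cell _
      · rw [projOut_request, projOut_output]
        exact CounterFollows.of_prefix hplay.1.2.2 hd'

theorem toSymmetric_toAffine : toSymmetric A.toAffine = A := by
  refine SymmetricAlgorithm.ext (funext fun x => Strategy.ext ?_) (funext fun α' => ?_)
  · exact Set.Subset.antisymm (applyFun_trace_subset A.f_mono x) (A.subset_applyFun x)
  · refine partialCarrier_injective ?_
    rw [toSymmetric, partialCarrier_applyPartial]
    exact Set.Subset.antisymm (applyCounter_trace_subset A.g_mono α') (A.subset_applyCounter α')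

theorem le_toAffine_toSymmetric (φ : Strategy (lolli S S')) : φ ≤ (toSymmetric φ).toAffine := by
  intro s hs
  refine ⟨φ.subset_responses hs, fun t ht hts => ?_⟩
  have htφ := φ.prefix_mem _ hs _ ht hts
  obtain ⟨hP, w, v' | c, rfl⟩ := ht
  · exact (realizes_output_iff hP).2 (mem_applyFun_iff.2 ⟨w, v', htφ, rfl, follows_below _⟩)
  · have hw := projOut_mem (mem_queries_of_append_value hP).1
    refine (realizes_valof_iff hP hw).2 ?_
    rw [toSymmetric, partialCarrier_applyPartial]
    exact mem_applyCounter_iff.2 ⟨w, c, htφ, rfl, counterFollows_counterBelow _ _⟩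

/-- An affine algorithm is recovered from its symmetric algorithm. Both `φ` and the recovered
algorithm define the same functions, and a response of the latter is determined by its contribution
to these functions. -/
theorem toAffine_toSymmetric (φ : Strategy (lolli S S')) : (toSymmetric φ).toAffine = φ := by
  refine le_antisymm (fun s hs => ?_) (le_toAffine_toSymmetric φ)
  have h := realizes_of_mem_trace hs
  obtain ⟨hP, w, v' | c, rfl⟩ := id hs.1
  · obtain ⟨t, u', ht, htu, htx⟩ := mem_applyFun_iff.1 ((realizes_output_iff hP).1 h)
    have heq : projOut w = projOut t := (List.append_inj' htu rfl).1
    have : w ++ [output v'] = t ++ [output u'] :=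
      eq_of_projOut_eq (x := below (projIn w)) hs (le_toAffine_toSymmetric φ ht) (follows_below _)
        htx heq
    change w ++ [output v'] ∈ φ.carrier
    rwa [this]
  · have hw := projOut_mem (mem_queries_of_append_value hP).1
    have h := (realizes_valof_iff hP hw).1 h
    rw [toSymmetric, partialCarrier_applyPartial] at h
    obtain ⟨t, d, ht, htd, htα⟩ := mem_applyCounter_iff.1 h
    have heq : projIn w = projIn t := (List.append_inj' htd rfl).1
    have : w ++ [valof c] = t ++ [valof d] :=
      eq_of_projIn_eq hs (le_toAffine_toSymmetric φ ht) (counterFollows_counterBelow _ hw) htα heq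
    change w ++ [valof c] ∈ φ.carrier
    rwa [this]

theorem toSymmetric_mono {φ ψ : Strategy (lolli S S')} (h : φ ≤ ψ) :
    toSymmetric φ ≤ toSymmetric ψ := by
  constructor
  · rintro x r' ⟨s, hs, hr'⟩
    exact ⟨s, h hs, hr'⟩
  · intro α'
    change applyPartial φ α' ≤ applyPartial ψ α'
    rw [← partialCarrier_subset_iff, partialCarrier_applyPartial, partialCarrier_applyPartial]
    rintro q ⟨s, hs, hq⟩
    exact ⟨s, h hs, hq⟩

theorem toAffine_mono {A B : SymmetricAlgorithm S S'} (h : A ≤ B) : A.toAffine ≤ B.toAffine := by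
  intro s hs
  refine ⟨hs.1, fun t ht hts => ?_⟩
  rcases hs.2 t ht hts with h₁ | ⟨hP, h₁⟩
  · exact Or.inl (h.1 _ h₁)
  · exact Or.inr ⟨hP, partialCarrier_subset_iff.2 (h.2 _) h₁⟩

/-- The order isomorphism between affine and symmetric algorithms. -/
noncomputable def affineSymmetricIso (S S' : SDS.{u}) :
    Strategy (lolli S S') ≃o SymmetricAlgorithm S S' where
  toFun := toSymmetric
  invFun := SymmetricAlgorithm.toAffine
  left_inv := toAffine_toSymmetric
  right_inv := toSymmetric_toAffine
  map_rel_iff' := by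
    intro φ ψ
    refine ⟨fun h => ?_, toSymmetric_mono⟩
    have := toAffine_mono h
    simpa [toAffine_toSymmetric] using this

end Symmetric

/-! ### Composition by the abstract machine -/

section Machine

variable {S S' S'' : SDS.{u}}

/-- The invariant of the states of the abstract machine: the three words are positions that agree on
their common projections, the first two are played according to `φ` and `φ'`, and `s''` is a
query exactly when one of `φ` and `φ'`, never both, has to move. -/
structure MachineInvariant (φ : Strategy (lolli S S')) (φ' : Strategy (lolli S' S''))
    (s : ArrowWord S S') (s' : ArrowWord S' S'') (s'' : ArrowWord S S'') : Prop where
  left_mem : s = [] ∨ s ∈ (lolli S S').P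
  right_mem : s' = [] ∨ s' ∈ (lolli S' S'').P
  mem : s'' = [] ∨ s'' ∈ (lolli S S'').P
  left_follows : Follows φ s
  right_follows : Follows φ' s'
  projIn_left : projIn s = projIn s''
  projOut_left : projOut s = projIn s'
  projOut_right : projOut s' = projOut s''
  not_both : ¬ (EndsCell s ∧ EndsCell s')
  turn : EndsCell s'' ↔ EndsCell s ∨ EndsCell s'

variable {φ : Strategy (lolli S S')} {φ' : Strategy (lolli S' S'')}

theorem mem_responses₀_iff {T : SDS.{u}} {w : T.Word} :
    w ∈ T.responses₀ ↔ (w = [] ∨ w ∈ T.P) ∧ ¬ EndsCell w := by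
  unfold responses₀
  rw [Set.mem_ofPred_eq, mem_responses_iff]
  constructor
  · rintro (rfl | ⟨h, h'⟩)
    · exact ⟨Or.inl rfl, not_endsCell_nil⟩
    · exact ⟨Or.inr h, h'⟩
  · rintro ⟨rfl | h, h'⟩
    · exact Or.inl rfl
    · exact Or.inr ⟨h, h'⟩

theorem ne_nil_of_endsCell {C V : Type*} {w : List (C ⊕ V)} (h : EndsCell w) : w ≠ [] := by
  rintro rfl
  exact not_endsCell_nil h

theorem nil_or_mem_of_append {T : SDS.{u}} {w : T.Word} {m : T.Move} (h : w ++ [m] ∈ T.P) :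
    w = [] ∨ w ∈ T.P := by
  by_cases hw : w = []
  · exact Or.inl hw
  · exact Or.inr (mem_P_of_append h hw)

/-- For a response, or the empty word, either both projections end with cells or none does. -/
theorem endsCell_projIn_iff_of_not_endsCell {s : ArrowWord S S'} (hs : s = [] ∨ s ∈ (lolli S S').P)
    (hc : ¬ EndsCell s) : EndsCell (projIn s) ↔ EndsCell (projOut s) := by
  rcases hs with rfl | hs
  · simp
  · exact endsCell_projIn_iff (mem_responses_iff.2 ⟨hs, hc⟩)

theorem projIn_append_is_mem {s : ArrowWord S S'} {v : S.V} (h : s ++ [is v] ∈ (lolli S S').P) :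
    projIn s ++ [Sum.inr v] ∈ S.P :=
  projIn_mem_of_append (w := projIn s) (m := Sum.inr v) h (by rw [projIn_is])

theorem projOut_append_request_mem {s : ArrowWord S S'} {c' : S'.C}
    (h : s ++ [request c'] ∈ (lolli S S').P) : projOut s ++ [Sum.inl c'] ∈ S'.P := by
  have := projOut_mem h
  rwa [projOut_request] at this

theorem projOut_append_output_mem {s : ArrowWord S S'} {v' : S'.V}
    (h : s ++ [output v'] ∈ (lolli S S').P) : projOut s ++ [Sum.inr v'] ∈ S'.P := by
  have := projOut_mem h
  rwa [projOut_output] at this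

theorem MachineInvariant.init : MachineInvariant φ φ' [] [] [] where
  left_mem := Or.inl rfl
  right_mem := Or.inl rfl
  mem := Or.inl rfl
  left_follows := Follows.nil φ
  right_follows := Follows.nil φ'
  projIn_left := rfl
  projOut_left := rfl
  projOut_right := rfl
  not_both h := not_endsCell_nil h.1
  turn := by simp

theorem MachineInvariant.step {a b : ArrowWord S S' × ArrowWord S' S'' × ArrowWord S S''}
    (hab : MachineStep φ φ' a b) (h : MachineInvariant φ φ' a.1 a.2.1 a.2.2) :
    MachineInvariant φ φ' b.1 b.2.1 b.2.2 := by
  obtain ⟨hl, hr, hm, hlf, hrf, hpi, hpl, hpr, -, -⟩ := h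
  cases hab with
  | observer_request r r' r'' c'' hr₁ hr₂ hr₃ h =>
    simp only at *
    rw [mem_responses₀_iff] at hr₁ hr₂ hr₃
    have hin : ¬ EndsCell (projIn r') := by
      rw [← hpl, ← endsCell_projIn_iff_of_not_endsCell hr₁.1 hr₁.2, hpi]
      have := not_endsCell_projIn h (by simp)
      rwa [projIn_request] at this
    have hP : r' ++ [request c''] ∈ (lolli S' S'').P := by
      refine append_request_mem hr₂.1 hr₂.2 hin ?_
      rw [hpr]
      exact projOut_append_request_mem h
    exact ⟨hl, Or.inr hP, Or.inr h, hlf, hrf.append_cell _, by simpa using hpi, by simpa using hpl,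
      by simpa using hpr, fun h => hr₁.2 h.1, by simp⟩
  | observer_is r r' r'' v hr₁ hr₂ hr₃ h =>
    simp only at *
    rw [mem_responses₀_iff] at hr₁ hr₂ hr₃
    have hv := projIn_append_is_mem h
    rw [← hpi] at hv
    have hP : r ++ [is v] ∈ (lolli S S').P := by
      refine append_is_mem (hr₁.1.resolve_left ?_) hr₁.2 hv
      rintro rfl
      exact not_endsCell_nil (endsCell_of_append_value hv)
    exact ⟨Or.inr hP, hr, Or.inr h, hlf.append_cell _, hrf, by simpa using hpi, by simpa using hpl,
      by simpa using hpr, fun h => hr₂.2 h.2, by simp⟩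
  | right_output r q' q'' v'' hr₁ hq' hq'' h =>
    simp only at *
    rw [mem_responses₀_iff] at hr₁
    have hP := (φ'.subset_responses h).1
    have hP'' : q'' ++ [output v''] ∈ (lolli S S'').P := by
      refine append_output_mem hq''.1 hq''.2 ?_
      rw [← hpr]
      exact projOut_append_output_mem hP
    exact ⟨hl, Or.inr hP, Or.inr hP'', hlf, Follows.of_mem h, by simpa using hpi,
      by simpa using hpl, by simpa using hpr, fun h => hr₁.2 h.1, by simpa using hr₁.2⟩
  | right_valof r q' q'' c' hr₁ hq' hq'' h =>
    simp only at *
    rw [mem_responses₀_iff] at hr₁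
    have hP := (φ'.subset_responses h).1
    have hP' : r ++ [request c'] ∈ (lolli S S').P := by
      refine append_request_mem hr₁.1 hr₁.2 ?_ ?_
      · rw [hpi]
        exact not_endsCell_projIn hq''.1 hq''.2
      · rw [hpl]
        exact (projIn_mem_queries hP).1
    exact ⟨Or.inr hP', Or.inr hP, hm, hlf.append_cell _, Follows.of_mem h, by simpa using hpi,
      by simpa using hpl, by simpa using hpr, by simp, by simpa using (mem_queries_iff.1 hq'').2⟩
  | left_output q r' q'' v' hq hr₂ hq'' h =>
    simp only at *
    rw [mem_responses₀_iff] at hr₂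
    have hP := (φ.subset_responses h).1
    have hv := projOut_append_output_mem hP
    rw [hpl] at hv
    have hP' : r' ++ [is v'] ∈ (lolli S' S'').P := by
      refine append_is_mem (hr₂.1.resolve_left ?_) hr₂.2 hv
      rintro rfl
      exact not_endsCell_nil (endsCell_of_append_value hv)
    exact ⟨Or.inr hP, Or.inr hP', hm, Follows.of_mem h, hrf.append_cell _, by simpa using hpi,
      by simpa using hpl, by simpa using hpr, by simp, by simpa using (mem_queries_iff.1 hq'').2⟩
  | left_valof q r' q'' c hq hr₂ hq'' h =>
    simp only at *
    rw [mem_responses₀_iff] at hr₂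
    have hP := (φ.subset_responses h).1
    have hP'' : q'' ++ [valof c] ∈ (lolli S S'').P := by
      refine append_valof_mem hq''.1 hq''.2 ?_
      rw [← hpi]
      exact (projIn_mem_queries hP).1
    exact ⟨Or.inr hP, hr, Or.inr hP'', Follows.of_mem h, hrf, by simpa using hpi,
      by simpa using hpl, by simpa using hpr, fun h => hr₂.2 h.2, by simpa using hr₂.2⟩

/-- The state `(s, s', s'')` of the machine is reachable from the initial state. -/
def Reachable (φ : Strategy (lolli S S')) (φ' : Strategy (lolli S' S'')) (s : ArrowWord S S')
    (s' : ArrowWord S' S'') (s'' : ArrowWord S S'') : Prop :=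
  Relation.ReflTransGen (MachineStep φ φ') ([], [], []) (s, s', s'')

theorem Reachable.invariant {s : ArrowWord S S'} {s' : ArrowWord S' S''} {s'' : ArrowWord S S''}
    (h : Reachable φ φ' s s' s'') : MachineInvariant φ φ' s s' s'' := by
  suffices ∀ a, Relation.ReflTransGen (MachineStep φ φ') ([], [], []) a →
      MachineInvariant φ φ' a.1 a.2.1 a.2.2 from this _ h
  intro a ha
  induction ha with
  | refl => exact MachineInvariant.init
  | tail _ hab ih => exact ih.step hab

/-- A step lengthens the third word of a state by at most one move. -/
theorem MachineStep.prefix_cases {a b : ArrowWord S S' × ArrowWord S' S'' × ArrowWord S S''}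
    (hab : MachineStep φ φ' a b) {t : ArrowWord S S''} (ht : t <+: b.2.2) :
    t = b.2.2 ∨ t <+: a.2.2 := by
  cases hab <;> first | exact List.prefix_concat_iff.1 ht | exact Or.inr ht

theorem Reachable.of_prefix {s : ArrowWord S S'} {s' : ArrowWord S' S''} {s'' t : ArrowWord S S''}
    (h : Reachable φ φ' s s' s'') (ht : t <+: s'') : ∃ u u', Reachable φ φ' u u' t := by
  suffices ∀ a, Relation.ReflTransGen (MachineStep φ φ') ([], [], []) a → t <+: a.2.2 →
      ∃ u u', Reachable φ φ' u u' t from this _ h ht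
  intro a ha
  induction ha with
  | refl =>
    intro ht
    obtain rfl : t = [] := List.prefix_nil.1 ht
    exact ⟨[], [], Relation.ReflTransGen.refl⟩
  | @tail b c hb hbc ih =>
    intro ht
    rcases hbc.prefix_cases ht with rfl | ht
    · exact ⟨c.1, c.2.1, hb.tail hbc⟩
    · exact ih ht

/-- Words of `φ` and `φ'` that agree on the intermediate sds can be interleaved by a run of the
machine. The last move of the run is determined by the last moves of the two words. -/
theorem exists_reachable {s : ArrowWord S S'} {s' : ArrowWord S' S''}
    (hs : s = [] ∨ s ∈ (lolli S S').P) (hs' : s' = [] ∨ s' ∈ (lolli S' S'').P)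
    (hφ : Follows φ s) (hφ' : Follows φ' s') (h : projOut s = projIn s')
    (hturn : ¬ (EndsCell s ∧ EndsCell s')) : ∃ s'', Reachable φ φ' s s' s'' := by
  induction hn : s.length + s'.length using Nat.strong_induction_on generalizing s s' with
  | _ n ih =>
  by_cases hc : EndsCell s
  · have hc' : ¬ EndsCell s' := fun h' => hturn ⟨hc, h'⟩
    obtain ⟨u, m, rfl⟩ := hc
    have hP : u ++ [Sum.inl m] ∈ (lolli S S').P := hs.resolve_left (by simp)
    have hu : u = [] ∨ u ∈ (lolli S S').P := nil_or_mem_of_append hP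
    have huφ : Follows φ u := hφ.of_prefix (List.prefix_append _ _)
    have huc : ¬ EndsCell u := not_endsCell_of_append_cell hP
    rcases m with c' | v
    · rw [projOut_request] at h
      have hne : s' ≠ [] := by
        rintro rfl
        simp at h
      have hs'r : s' ∈ (lolli S' S'').responses :=
        mem_responses_iff.2 ⟨hs'.resolve_left hne, hc'⟩
      obtain ⟨t, d, rfl⟩ := exists_valof hs'r
        ((endsCell_projIn_iff hs'r).1 (by rw [← h]; simp))
      rw [projIn_valof] at h
      obtain ⟨ht, hd⟩ := List.append_inj' h rfl
      obtain rfl : c' = d := by simpa using hd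
      have htq := mem_queries_of_append_value hs'r.1
      obtain ⟨t'', ht''⟩ := ih _ (by simp at hn; omega) hu (Or.inr htq.1) huφ
        (hφ'.of_prefix (List.prefix_append _ _)) ht (fun h => huc h.1) rfl
      have hinv := ht''.invariant
      have hc'' := hinv.turn.2 (Or.inr htq.2)
      exact ⟨t'', ht''.tail (MachineStep.right_valof u t t'' c' (mem_responses₀_iff.2 ⟨hu, huc⟩) htq
        ⟨hinv.mem.resolve_left (ne_nil_of_endsCell hc''), hc''⟩
        (hφ' _ hs'r List.prefix_rfl))⟩
    · rw [projOut_is] at h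
      obtain ⟨t'', ht''⟩ := ih _ (by simp at hn; omega) hu hs' huφ hφ' h (fun h => huc h.1) rfl
      have hinv := ht''.invariant
      have hc'' : ¬ EndsCell t'' := fun h => (hinv.turn.1 h).elim huc hc'
      have hv := projIn_append_is_mem hP
      rw [hinv.projIn_left] at hv
      have hP'' : t'' ++ [is v] ∈ (lolli S S'').P := by
        refine append_is_mem (hinv.mem.resolve_left ?_) hc'' hv
        rintro rfl
        exact not_endsCell_nil (endsCell_of_append_value hv)
      exact ⟨_, ht''.tail (MachineStep.observer_is u s' t'' v (mem_responses₀_iff.2 ⟨hu, huc⟩)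
        (mem_responses₀_iff.2 ⟨hs', hc'⟩) (mem_responses₀_iff.2 ⟨hinv.mem, hc''⟩) hP'')⟩
  by_cases hc' : EndsCell s'
  · obtain ⟨t, m, rfl⟩ := id hc'
    have hP : t ++ [Sum.inl m] ∈ (lolli S' S'').P := hs'.resolve_left (by simp)
    have ht : t = [] ∨ t ∈ (lolli S' S'').P := nil_or_mem_of_append hP
    have htφ : Follows φ' t := hφ'.of_prefix (List.prefix_append _ _)
    have htc : ¬ EndsCell t := not_endsCell_of_append_cell hP
    rcases m with c'' | v'
    · have hin := not_endsCell_projIn hP hc'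
      rw [projIn_request] at h hin
      obtain ⟨t'', ht''⟩ := ih _ (by simp at hn; omega) hs ht hφ htφ h (fun h => hc h.1) rfl
      have hinv := ht''.invariant
      have htc'' : ¬ EndsCell t'' := fun h => (hinv.turn.1 h).elim hc htc
      have hP'' : t'' ++ [request c''] ∈ (lolli S S'').P := by
        refine append_request_mem hinv.mem htc'' ?_ ?_
        · rwa [← hinv.projIn_left, endsCell_projIn_iff_of_not_endsCell hs hc, h]
        · rw [← hinv.projOut_right]
          exact projOut_append_request_mem hP
      exact ⟨_, ht''.tail (MachineStep.observer_request s t t'' c''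
        (mem_responses₀_iff.2 ⟨hs, hc⟩) (mem_responses₀_iff.2 ⟨ht, htc⟩)
        (mem_responses₀_iff.2 ⟨hinv.mem, htc''⟩) hP'')⟩
    · rw [projIn_is] at h
      have hne : s ≠ [] := by
        rintro rfl
        simp at h
      have hsr : s ∈ (lolli S S').responses := mem_responses_iff.2 ⟨hs.resolve_left hne, hc⟩
      obtain ⟨u, u', rfl⟩ := exists_output hsr
        (by rw [endsCell_projIn_iff hsr, h]; simp)
      rw [projOut_output] at h
      obtain ⟨hu, hu'⟩ := List.append_inj' h rfl
      obtain rfl : u' = v' := by simpa using hu'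
      have huq := mem_queries_of_append_value hsr.1
      obtain ⟨t'', ht''⟩ := ih _ (by simp at hn; omega) (Or.inr huq.1) ht
        (hφ.of_prefix (List.prefix_append _ _)) htφ hu (fun h => htc h.2) rfl
      have hinv := ht''.invariant
      have hc'' := hinv.turn.2 (Or.inl huq.2)
      exact ⟨t'', ht''.tail (MachineStep.left_output u t t'' u' huq
        (mem_responses₀_iff.2 ⟨ht, htc⟩)
        ⟨hinv.mem.resolve_left (ne_nil_of_endsCell hc''), hc''⟩ (hφ _ hsr List.prefix_rfl))⟩
  by_cases hne : s' = []
  · subst hne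
    obtain rfl : s = [] := by
      by_contra hne
      exact S'.ne_nil _ (projOut_mem (hs.resolve_left hne)) h
    exact ⟨[], Relation.ReflTransGen.refl⟩
  have hs'r : s' ∈ (lolli S' S'').responses := mem_responses_iff.2 ⟨hs'.resolve_left hne, hc'⟩
  rcases response_cases hs'r with ⟨t, v'', rfl, -⟩ | ⟨t, c', rfl, hin, -⟩
  · rw [projIn_output] at h
    have htq := mem_queries_of_append_value hs'r.1
    obtain ⟨t'', ht''⟩ := ih _ (by simp at hn; omega) hs (Or.inr htq.1) hφ
      (hφ'.of_prefix (List.prefix_append _ _)) h (fun h => hc h.1) rfl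
    have hinv := ht''.invariant
    have hc'' := hinv.turn.2 (Or.inr htq.2)
    exact ⟨_, ht''.tail (MachineStep.right_output s t t'' v'' (mem_responses₀_iff.2 ⟨hs, hc⟩) htq
      ⟨hinv.mem.resolve_left (ne_nil_of_endsCell hc''), hc''⟩ (hφ' _ hs'r List.prefix_rfl))⟩
  · rw [← h] at hin
    have hsr : s ∈ (lolli S S').responses := by
      refine mem_responses_iff.2 ⟨hs.resolve_left ?_, hc⟩
      rintro rfl
      exact not_endsCell_nil hin
    obtain ⟨u, c, rfl⟩ := exists_valof hsr hin
    rw [projOut_valof] at h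
    have huq := mem_queries_of_append_value hsr.1
    obtain ⟨t'', ht''⟩ := ih _ (by simp at hn ⊢; omega) (Or.inr huq.1) hs'
      (hφ.of_prefix (List.prefix_append _ _)) hφ' h (fun h => hc' h.2) rfl
    have hinv := ht''.invariant
    have hc'' := hinv.turn.2 (Or.inl huq.2)
    exact ⟨_, ht''.tail (MachineStep.left_valof u _ t'' c huq (mem_responses₀_iff.2 ⟨hs', hc'⟩)
      ⟨hinv.mem.resolve_left (ne_nil_of_endsCell hc''), hc''⟩ (hφ _ hsr List.prefix_rfl))⟩

/-- Interleaving responses of `φ` (or the empty word) and `φ'` yields an element of the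
composition. -/
theorem exists_mem_machineComp {s : ArrowWord S S'} {s' : ArrowWord S' S''}
    (hs : s = [] ∨ s ∈ φ.carrier) (hs' : s' ∈ φ'.carrier) (h : projOut s = projIn s') :
    ∃ s'' ∈ machineComp φ φ', projIn s'' = projIn s ∧ projOut s'' = projOut s' := by
  have hs'r := mem_responses_iff.1 (φ'.subset_responses hs')
  have hs₀ : (s = [] ∨ s ∈ (lolli S S').P) ∧ ¬ EndsCell s := by
    rcases hs with rfl | hs
    · exact ⟨Or.inl rfl, not_endsCell_nil⟩
    · have := mem_responses_iff.1 (φ.subset_responses hs)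
      exact ⟨Or.inr this.1, this.2⟩
  obtain ⟨s'', hs''⟩ := exists_reachable hs₀.1 (Or.inr hs'r.1) (Follows.of_nil_or_mem hs)
    (Follows.of_mem hs') h (fun h => hs₀.2 h.1)
  have hinv := hs''.invariant
  refine ⟨s'', ⟨mem_responses_iff.2 ⟨hinv.mem.resolve_left ?_, fun h => ?_⟩, s, s', hs''⟩,
    hinv.projIn_left.symm, hinv.projOut_right.symm⟩
  · rintro rfl
    exact S''.ne_nil _ (projOut_mem hs'r.1) hinv.projOut_right
  · exact (hinv.turn.1 h).elim hs₀.2 hs'r.2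

/-- An element of the composition arises from responses of `φ` (or the empty word) and `φ'`. -/
theorem exists_mem_of_mem_machineComp {s'' : ArrowWord S S''} (h : s'' ∈ machineComp φ φ') :
    ∃ s s', (s = [] ∨ s ∈ φ.carrier) ∧ s' ∈ φ'.carrier ∧ projOut s = projIn s' ∧
      projIn s'' = projIn s ∧ projOut s'' = projOut s' := by
  obtain ⟨hr, s, s', hs⟩ := h
  have hinv := Reachable.invariant hs
  have hr := mem_responses_iff.1 hr
  have hc : ¬ EndsCell s := fun h => hr.2 (hinv.turn.2 (Or.inl h))
  have hc' : ¬ EndsCell s' := fun h => hr.2 (hinv.turn.2 (Or.inr h))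
  refine ⟨s, s', hinv.left_mem.imp id fun hP => ?_, ?_, hinv.projOut_left, hinv.projIn_left.symm,
    hinv.projOut_right.symm⟩
  · exact hinv.left_follows _ (mem_responses_iff.2 ⟨hP, hc⟩) List.prefix_rfl
  · refine hinv.right_follows _ (mem_responses_iff.2 ⟨hinv.right_mem.resolve_left ?_, hc'⟩)
      List.prefix_rfl
    rintro rfl
    exact S''.ne_nil _ (projOut_mem hr.1) hinv.projOut_right.symm

theorem partialComp_eq_coe_iff {A B : Type*} {g : CounterStrategy S' → WithBot A}
    {g' : B → WithBot (CounterStrategy S')} {b : B} {a : A} :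
    partialComp g g' b = a ↔ ∃ β : CounterStrategy S', g' b = β ∧ g β = a := by
  unfold partialComp
  cases hb : g' b with
  | bot => simp
  | coe β =>
    constructor
    · exact fun h => ⟨β, rfl, h⟩
    · rintro ⟨γ, hγ, h⟩
      rwa [WithBot.coe_injective hγ]

theorem mem_partialCarrier_partialComp_iff {B : Type*}
    {g : CounterStrategy S' → WithBot (CounterStrategy S)}
    {g' : B → WithBot (CounterStrategy S')} {b : B} {q : S.Word} :
    q ∈ partialCarrier (partialComp g g' b) ↔
      ∃ β : CounterStrategy S', g' b = β ∧ q ∈ partialCarrier (g β) := by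
  constructor
  · rintro ⟨α, hα, hq⟩
    obtain ⟨β, hβ, hα⟩ := partialComp_eq_coe_iff.1 hα
    exact ⟨β, hβ, α, hα, hq⟩
  · rintro ⟨β, hβ, α, hα, hq⟩
    exact ⟨α, partialComp_eq_coe_iff.2 ⟨β, hβ, hα⟩, hq⟩

theorem mem_partialComp_applyPartial_iff {α'' : CounterStrategy S''} {q : S.Word} :
    q ∈ partialCarrier (partialComp (applyPartial φ) (applyPartial φ') α'') ↔
      ∃ s ∈ φ.carrier, q = projIn s ∧ ∃ s' ∈ φ'.carrier, projOut s = projIn s' ∧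
        projOut s' ∈ α''.carrier := by
  rw [mem_partialCarrier_partialComp_iff]
  constructor
  · rintro ⟨β, hβ, hq⟩
    rw [partialCarrier_applyPartial] at hq
    obtain ⟨s, hs, rfl, hsβ⟩ := hq
    obtain ⟨s', hs', h, hα⟩ := (mem_of_applyPartial_eq hβ).1 hsβ
    exact ⟨s, hs, rfl, s', hs', h, hα⟩
  · rintro ⟨s, hs, rfl, s', hs', h, hα⟩
    have hmem : projOut s ∈ partialCarrier (applyPartial φ' α'') := by
      rw [partialCarrier_applyPartial]
      exact ⟨s', hs', h, hα⟩
    obtain ⟨β, hβ, hsβ⟩ := hmem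
    refine ⟨β, hβ, ?_⟩
    rw [partialCarrier_applyPartial]
    exact ⟨s, hs, rfl, hsβ⟩

theorem applyFun_comp_eq {φ'' : Strategy (lolli S S'')} (h : φ''.carrier = machineComp φ φ')
    (x : Strategy S) : applyFun φ'' x = applyFun φ' (applyStrategy φ x) := by
  ext r''
  constructor
  · rintro ⟨s'', hs'', rfl, hx⟩
    rw [h] at hs''
    obtain ⟨s, s', hs, hs', hss', hin, hout⟩ := exists_mem_of_mem_machineComp hs''
    refine ⟨s', hs', hout, ?_⟩
    rcases hs with rfl | hs
    · exact Or.inl hss'.symm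
    · exact Or.inr ⟨s, hs, hss'.symm, by rwa [← hin]⟩
  · rintro ⟨s', hs', rfl, hx⟩
    rcases hx with hx | ⟨s, hs, hss', hx⟩
    · obtain ⟨s'', hs'', hin, hout⟩ := exists_mem_machineComp (φ := φ) (Or.inl rfl) hs' hx.symm
      exact ⟨s'', by rwa [h], hout.symm, Or.inl hin⟩
    · obtain ⟨s'', hs'', hin, hout⟩ := exists_mem_machineComp (Or.inr hs) hs' hss'.symm
      exact ⟨s'', by rwa [h], hout.symm, by rwa [hin]⟩

theorem applyCounter_comp_eq {φ'' : Strategy (lolli S S'')} (h : φ''.carrier = machineComp φ φ')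
    (α'' : CounterStrategy S'') : applyCounter φ'' α'' =
      partialCarrier (partialComp (applyPartial φ) (applyPartial φ') α'') := by
  ext q
  rw [mem_partialComp_applyPartial_iff]
  constructor
  · rintro ⟨s'', hs'', rfl, hα⟩
    have hc := (α''.subset_queries hα).2
    have hr := φ''.subset_responses hs''
    rw [h] at hs''
    obtain ⟨s, s', hs, hs', hss', hin, hout⟩ := exists_mem_of_mem_machineComp hs''
    refine ⟨s, hs.resolve_left ?_, hin, s', hs', hss', by rwa [← hout]⟩
    rintro rfl
    exact ne_nil_of_endsCell ((endsCell_projIn_iff hr).2 hc) hin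
  · rintro ⟨s, hs, rfl, s', hs', hss', hα⟩
    obtain ⟨s'', hs'', hin, hout⟩ := exists_mem_machineComp (Or.inr hs) hs' hss'
    exact ⟨s'', by rwa [h], hin.symm, by rwa [hout]⟩

/-- The composite of two symmetric algorithms is orthogonal: the play between `A.f x` and `B.g α''`
in the intermediate sds would be won by both players. -/
theorem Orthogonal.comp (A : SymmetricAlgorithm S S') (B : SymmetricAlgorithm S' S'') :
    Orthogonal (B.f ∘ A.f) (partialComp A.g B.g) := by
  intro p p'' hp'' α hα hwin hlose
  obtain ⟨β, hβ, hα⟩ := partialComp_eq_coe_iff.1 hα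
  obtain ⟨m, hm, q', hq', hplay, _⟩ := A.axiomR β (below p) α (below_finite _) hα hlose
  obtain ⟨y, -, hy | ⟨γ, r', hγ, hr', hplay', -⟩⟩ :=
    B.axiomL (A.f (below p)) (counterBelow p'' hp'') (counterBelow_finite _ _) hwin
  · rw [hβ] at hy
    exact WithBot.coe_ne_bot hy.1
  · obtain rfl : β = γ := WithBot.coe_injective (hβ.symm.trans hγ)
    exact not_wins_and_loses ⟨r', hr', hplay'⟩ ⟨q', hq', hplay⟩

theorem realizes_of_mem_machineComp {s'' : ArrowWord S S''} (h : s'' ∈ machineComp φ φ') :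
    Realizes ((toSymmetric φ').f ∘ (toSymmetric φ).f)
      (partialComp (toSymmetric φ).g (toSymmetric φ').g) s'' := by
  have hr := h.1
  obtain ⟨s, s', hs, hs', hss', hin, hout⟩ := exists_mem_of_mem_machineComp h
  have hP := projOut_mem hr.1
  by_cases hc : EndsCell (projIn s'')
  · have hc' := (endsCell_projIn_iff hr).1 hc
    refine Or.inr ⟨hP, mem_partialComp_applyPartial_iff.2
      ⟨s, hs.resolve_left ?_, hin, s', hs', hss', ?_⟩⟩
    · rintro rfl
      exact ne_nil_of_endsCell hc hin
    · rw [← hout]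
      exact ⟨⟨hP, hc'⟩, List.prefix_rfl⟩
  · refine Or.inl ⟨s', hs', hout, ?_⟩
    rcases hs with rfl | hs
    · exact Or.inl hss'.symm
    · refine Or.inr ⟨s, hs, hss'.symm, ?_⟩
      rw [← hin]
      exact (projIn_nil_or_mem_responses hr.1 hc).imp id fun h => ⟨h, List.prefix_rfl⟩

theorem machineComp_prefix_mem {s t : ArrowWord S S''} (hs : s ∈ machineComp φ φ')
    (ht : t ∈ (lolli S S'').responses) (hts : t <+: s) : t ∈ machineComp φ φ' := by
  obtain ⟨-, u, u', hu⟩ := hs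
  exact ⟨ht, Reachable.of_prefix hu hts⟩

/-- The composition by the abstract machine, as an affine algorithm. It answers each query at most
once because it is contained in the algorithm of the composite functions. -/
def machineStrategy (φ : Strategy (lolli S S')) (φ' : Strategy (lolli S' S'')) :
    Strategy (lolli S S'') :=
  Strategy.ofUnique (machineComp φ φ') (fun _ h => h.1)
    (fun _ hr _ ht htr => machineComp_prefix_mem hr ht htr)
    (fun _ _ _ h₁ h₂ =>
      have hsub : ∀ s ∈ machineComp φ φ', s ∈ (trace _ _
          (Orthogonal.comp (toSymmetric φ) (toSymmetric φ'))).carrier :=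
        fun _ hs => ⟨hs.1, fun _ ht hts => realizes_of_mem_machineComp
          (machineComp_prefix_mem hs ht hts)⟩
      Strategy.value_unique _ (hsub _ h₁) (hsub _ h₂))

end Machine

end SDS

theorem theorem3p14 :
    ∃ Φ : ∀ S S' : SDS.{u}, SDS.Strategy (SDS.lolli S S') ≃o SDS.SymmetricAlgorithm S S',
      (∀ (S S' : SDS.{u}) (φ : SDS.Strategy (SDS.lolli S S')),
        (∀ x : SDS.Strategy S, ((Φ S S' φ).f x).carrier = SDS.applyFun φ x) ∧
        (∀ α' : SDS.CounterStrategy S',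
          SDS.partialCarrier ((Φ S S' φ).g α') = SDS.applyCounter φ α')) ∧
      (∀ (S S' S'' : SDS.{u}) (φ : SDS.Strategy (SDS.lolli S S'))
        (φ' : SDS.Strategy (SDS.lolli S' S'')),
        ∃ φ'' : SDS.Strategy (SDS.lolli S S''),
          φ''.carrier = SDS.machineComp φ φ' ∧
          (Φ S S'' φ'').f = (Φ S' S'' φ').f ∘ (Φ S S' φ).f ∧
          (Φ S S'' φ'').g = SDS.partialComp (Φ S S' φ).g (Φ S' S'' φ').g) := by
  refine ⟨SDS.affineSymmetricIso, fun S S' φ => ⟨fun x => rfl, fun α' => ?_⟩,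
    fun S S' S'' φ φ' => ⟨SDS.machineStrategy φ φ', rfl, funext fun x => ?_, funext fun α'' => ?_⟩⟩
  · exact SDS.partialCarrier_applyPartial φ α'
  · exact SDS.Strategy.ext (SDS.applyFun_comp_eq rfl x)
  · exact SDS.partialCarrier_injective
      ((SDS.partialCarrier_applyPartial _ _).trans (SDS.applyCounter_comp_eq rfl α''))
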